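/- All graphs are finite and simple, and "polynomial time" means time polynomial in the length of the input on a deterministic Turing machine (numbers in inputs and outputs are rationals written in binary). $(k,r)$-Independent-Set is the following search problem: given a $k$-colorable graph $G$ on $n$ vertices, find an independent set of $G$ of size at least $n/r$. For reals $p,\epsilon,c$ and integers $k,r$, $(k,r,p,\epsilon,c)$-Completion is the following search problem. The input is a symmetric partial matrix $A\in(\mathbb{Q}\cup\{\bot\})^{n\times n}$ whose set $\Omega=\{(i,j): A(i,j)\neq\bot\}$ of revealed positions satisfies $|\Omega|\ge pn^2$, with the promise that there is a symmetric real $n\times n$ matrix $M$ of rank $k$ such that $|M(i,j)|\le c$ for all $i,j$, and $M(i,j)=A(i,j)$ for all $(i,j)\in\Omega$. The output has to be an $n\times n$ matrix $B$ of rank at most $r$ such that $|B(i,j)|\le c$ for all $i,j$, and $\sum_{(i,j)\in\Omega}|A(i,j)-B(i,j)|^2\le \epsilon n$. The problem on matrices of coherence at most $\mu$ is the restriction to inputs for which $M$ can moreover be chosen with a singular value decomposition $M=U\Sigma V^\top$ (where $U,V\in\mathbb{R}^{n\times k}$ have orthonormal columns and $\Sigma$ is diagonal with positive diagonal entries) such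 that every row of $U$ and every row of $V$ has Euclidean norm at most $\sqrt{k\mu/n}$. **Theorem.** Assume that for all integers $r\ge k\ge 3$ there is no polynomial-time algorithm for $(k,r)$-Independent-Set. Then there is a constant $\mu$ such that for all integers $k\ge 4$ and $r>k$, and all reals $c>0$ and $0<\epsilon<1/(2cr)^2$, there is no polynomial-time algorithm that solves $(k,r,0.9,\epsilon,c)$-Completion on matrices of coherence at most $\mu$. -/

import Mathlib

/-! ### Search problems and polynomial time -/

/-- The finite alphabet in which instances and solutions are written. -/
inductive Letter
  | bit (b : Bool)
  | bot
  | minus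
  | slash
  | comma
  | newline
  deriving DecidableEq, Fintype

/-- A promise search problem: given an instance that satisfies the promise, find a solution of it.
Instances and candidate solutions are written as words over `Letter`. -/
structure SearchProblem where
  /-- instances -/
  Instance : Type
  /-- candidate solutions -/
  Candidate : Instance → Type
  /-- the inputs that an algorithm has to handle -/
  Promise : Instance → Prop
  /-- the correct outputs -/
  IsSolution : ∀ x, Candidate x → Prop
  /-- the word that represents an instance -/
  encodeInstance : Instance → List Letter
  /-- the word that represents a candidate solution -/
  encodeCandidate : ∀ x, Candidate x → List Letter

/-- The problem is solved by a polynomial-time algorithm: there are a Turing machine (in Mathlib's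
multi-stack formulation) and a polynomial such that, on the word of every instance that satisfies
the promise, the machine halts within the polynomial bound in the length of that word, and its
output is the word of a solution. -/
def SearchProblem.SolvableInPolyTime (Q : SearchProblem) : Prop :=
  ∃ (T : Turing.TM2ComputableAux Letter Letter) (time : Polynomial ℕ),
    ∀ x : Q.Instance, Q.Promise x →
      ∃ y : Q.Candidate x, Q.IsSolution x y ∧
        Nonempty (Turing.TM2OutputsInTime T.tm
          ((Q.encodeInstance x).map T.inputAlphabet.symm)
          (some ((Q.encodeCandidate x y).map T.outputAlphabet.symm))
          (time.eval (Q.encodeInstance x).length))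

/-! ### Words for numbers, matrices and sets of vertices -/

/-- Binary representation, least significant bit first. -/
def encodeNatural (m : ℕ) : List Letter := m.bits.map Letter.bit

/-- A rational number in lowest terms: sign, numerator and denominator in binary. -/
def encodeRational (q : ℚ) : List Letter :=
  (if q < 0 then [Letter.minus] else []) ++ encodeNatural q.num.natAbs ++
    [Letter.slash] ++ encodeNatural q.den

/-- A revealed entry is a rational number, a hidden entry is the symbol `⊥`. -/
def encodeEntry : Option ℚ → List Letter
  | none => [Letter.bot]
  | some q => encodeRational q

/-- A square matrix, row by row; `e` writes a single entry. -/
def encodeMatrix {α : Type} {n : ℕ} (e : α → List Letter) (A : Matrix (Fin n) (Fin n) α) :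
    List Letter :=
  (List.ofFn fun i : Fin n =>
    (List.ofFn fun j : Fin n => e (A i j) ++ [Letter.comma]).flatten ++ [Letter.newline]).flatten

open Classical in
/-- A graph, through its adjacency matrix. -/
noncomputable def encodeGraph {n : ℕ} (G : SimpleGraph (Fin n)) : List Letter :=
  encodeMatrix (fun b : Bool => [Letter.bit b]) (fun i j => decide (G.Adj i j))

/-- A set of vertices, through its indicator vector. -/
def encodeVertexSet {n : ℕ} (T : Finset (Fin n)) : List Letter :=
  List.ofFn fun i : Fin n => Letter.bit (decide (i ∈ T))

/-! ### Independent sets in colorable graphs -/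

/-- Given a `k`-colorable graph on `n` vertices, find an independent set with at least `n / r`
vertices. -/
noncomputable def independentSetProblem (k r : ℕ) : SearchProblem where
  Instance := Σ n : ℕ, SimpleGraph (Fin n)
  Candidate x := Finset (Fin x.1)
  Promise x := x.2.Colorable k
  IsSolution x T := x.2.IsIndepSet (T : Set (Fin x.1)) ∧ (x.1 : ℝ) / r ≤ (T.card : ℝ)
  encodeInstance x := encodeGraph x.2
  encodeCandidate _ T := encodeVertexSet T

/-! ### Matrix completion -/

/-- The set of revealed positions of a partial matrix (`none` stands for `⊥`). -/
def revealed {n : ℕ} (A : Matrix (Fin n) (Fin n) (Option ℚ)) : Finset (Fin n × Fin n) :=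
  Finset.univ.filter fun ij => (A ij.1 ij.2).isSome

/-- The real matrix `M` agrees with the partial matrix `A` on the revealed positions. -/
def Completes {n : ℕ} (M : Matrix (Fin n) (Fin n) ℝ) (A : Matrix (Fin n) (Fin n) (Option ℚ)) :
    Prop :=
  ∀ i j q, A i j = some q → M i j = (q : ℝ)

/-- The total squared error of `B` over the revealed positions of `A`. The default value of `getD`
is never used, as `A` has a value at each revealed position. -/
noncomputable def squaredError {n : ℕ} (A : Matrix (Fin n) (Fin n) (Option ℚ))
    (B : Matrix (Fin n) (Fin n) ℝ) : ℝ :=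
  ∑ ij ∈ revealed A, |(((A ij.1 ij.2).getD 0 : ℚ) : ℝ) - B ij.1 ij.2| ^ 2

/-- The `n × n` matrix `M` of rank `k` has coherence (at most) `μ`: there is a singular value
decomposition `M = U Σ Vᵀ`, where `U` and `V` are `n × k` matrices with orthonormal columns and `Σ`
is diagonal with positive entries, such that all rows of `U` and `V` have Euclidean norm at most
`√(k μ / n)`. -/
def HasCoherence {n : ℕ} (M : Matrix (Fin n) (Fin n) ℝ) (k : ℕ) (μ : ℝ) : Prop :=
  ∃ (U V : Matrix (Fin n) (Fin k) ℝ) (s : Fin k → ℝ),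
    U.transpose * U = 1 ∧ V.transpose * V = 1 ∧ (∀ l, 0 < s l) ∧
    M = U * Matrix.diagonal s * V.transpose ∧
    (∀ i, √(∑ l, U i l ^ 2) ≤ √(k * μ / n)) ∧
    (∀ i, √(∑ l, V i l ^ 2) ≤ √(k * μ / n))

/-- Matrix completion with parameters `(k, r, p, ε, c)` on matrices of coherence at most `μ`.

The instance is a symmetric partial matrix `A` with at least `p n²` revealed entries, such that some
symmetric real matrix of rank `k` and coherence at most `μ`, with entries bounded by `c`, agrees
with `A` on the revealed positions. A solution is a matrix `B` of rank at most `r`, with entries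
bounded by `c`, whose total squared error over the revealed positions is at most `ε n`.
As the algorithms are Turing machines, the entries of `A` and `B` are rational; the hidden matrix is
real. -/
noncomputable def completionProblem (k r : ℕ) (p ε c μ : ℝ) : SearchProblem where
  Instance := Σ n : ℕ, Matrix (Fin n) (Fin n) (Option ℚ)
  Candidate x := Matrix (Fin x.1) (Fin x.1) ℚ
  Promise x :=
    x.2.IsSymm ∧ p * (x.1 : ℝ) ^ 2 ≤ ((revealed x.2).card : ℝ) ∧
      ∃ M : Matrix (Fin x.1) (Fin x.1) ℝ,
        M.IsSymm ∧ M.rank = k ∧ HasCoherence M k μ ∧ (∀ i j, |M i j| ≤ c) ∧ Completes M x.2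
  IsSolution x B :=
    (B.map ((↑) : ℚ → ℝ)).rank ≤ r ∧ (∀ i j, |(B i j : ℝ)| ≤ c) ∧
      squaredError x.2 (B.map ((↑) : ℚ → ℝ)) ≤ ε * x.1
  encodeInstance x := encodeMatrix encodeEntry x.2
  encodeCandidate _ B := encodeMatrix encodeRational B

open Turing

/-! ### Structured programs on stacks of letters -/

/-! The proof reduces `independentSetProblem k R`, for a constant `R`, to matrix completion.

From a graph on `n` vertices, build a block matrix with `t` uncoloured blocks, each a copy of the
vertex set, and `5 * t` blocks of padding vertices for each of the `k` colours. Between copies, the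
entry is `d` at equal vertices, `0` at edges and hidden at non-edges. Between padding blocks
everything is revealed: `d` for equal colours, `0` otherwise. Mixed blocks are hidden, since their
entries would depend on an unknown colouring. A proper `k`-colouring of the graph extends to all
vertices, and the matrix with `d` at pairs of equal colour completes the instance. Its singular
vectors are the normalised indicators of the colour classes, and the padding makes these classes
large, whence rank `k` and coherence at most `2` (`colorMatrix_svd`, `promise_blowUp_blockEntry`).
The padding also reveals nine tenths of the entries.

Conversely, let `B` be a solution. Its error is at most linear in the size of the matrix, while
there are `t ^ 2` pairs of copies, so for a large constant `t` some pair yields an `n × n` submatrix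
`C` with error at most `d ^ 2 / 128 * n` (`exists_copies_error_le`). The rows of `C` are bounded and
span a space of dimension at most `r`. Hence they fall into a constant number `Q` of classes of
sup-norm diameter `d / 8` (`exists_row_classes`, by iterated coverings). At least half of the rows
have small error, so one class contains at least `n / (2 * Q)` of these. A single row `i₀` of that
class is then large at each vertex of the class and small at all its neighbours
(`exists_separating_row`). Thresholding row `i₀` gives a vertex set in which all those vertices are
isolated, and the isolated vertices of any set are independent. The algorithm does not know the
copies or the row, so it tries every piece of `n` consecutive entries in every row of `B`. A crude
threshold suffices because of the gap between `d / 2` and `d / 4`: for `d = 2 / 2 ^ e` it only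
compares the bit lengths of numerator and denominator (`isLarge`).

The remaining work is to realise this as a Turing machine that calls a given machine for completion.
A small structured language with big-step semantics is compiled to a multi-stack machine
(`Exec.sound`), and loop invariants for each routine give the output and the number of steps
(`exec_reduction`, `solvableInPolyTime_of_blowUp`). Only jumps cost a step, as straight-line code
runs within one step of the machine. -/

/-- The work stacks of a structured program. -/
inductive Stack
  | inp | graph | graph' | count | count' | row | row' | diag | diag' | word | word' | sel | sel'
  | out
  deriving DecidableEq

instance : Fintype Stack :=
  ⟨{.inp, .graph, .graph', .count, .count', .row, .row', .diag, .diag', .word, .word', .sel, .sel',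
    .out}, fun k => by cases k <;> decide⟩

/-- The contents of the work stacks. -/
structure Store where
  (inp graph graph' count count' row row' diag diag' word word' sel sel' out : List Letter)

namespace Store

/-- The content of a stack. -/
def get (s : Store) : Stack → List Letter
  | .inp => s.inp | .graph => s.graph | .graph' => s.graph' | .count => s.count
  | .count' => s.count' | .row => s.row | .row' => s.row' | .diag => s.diag | .diag' => s.diag'
  | .word => s.word | .word' => s.word' | .sel => s.sel | .sel' => s.sel' | .out => s.out

/-- Replace the content of a stack. -/
def set (s : Store) (k : Stack) (w : List Letter) : Store :=
  match k with
  | .inp => { s with inp := w } | .graph => { s with graph := w }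
  | .graph' => { s with graph' := w } | .count => { s with count := w }
  | .count' => { s with count' := w } | .row => { s with row := w }
  | .row' => { s with row' := w } | .diag => { s with diag := w }
  | .diag' => { s with diag' := w } | .word => { s with word := w }
  | .word' => { s with word' := w } | .sel => { s with sel := w }
  | .sel' => { s with sel' := w } | .out => { s with out := w }

theorem get_set (s : Store) (k : Stack) (w : List Letter) :
    (s.set k w).get = Function.update s.get k w := by
  funext j
  cases k <;> cases j <;> rfl

@[simp] theorem get_set_self (s : Store) (k : Stack) (w : List Letter) : (s.set k w).get k = w := by
  cases k <;> rfl

@[simp] theorem set_set (s : Store) (k : Stack) (v w : List Letter) :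
    (s.set k v).set k w = s.set k w := by
  cases k <;> rfl

theorem set_comm (s : Store) {k j : Stack} (h : k ≠ j) (v w : List Letter) :
    (s.set k v).set j w = (s.set j w).set k v := by
  cases k <;> cases j <;> first | rfl | exact absurd rfl h

@[simp] theorem set_get (s : Store) (k : Stack) : s.set k (s.get k) = s := by
  cases k <;> rfl

theorem get_set_of_ne (s : Store) {k j : Stack} (h : j ≠ k) (w : List Letter) :
    (s.set k w).get j = s.get j := by
  rw [get_set, Function.update_of_ne h]

end Store

/-- The registers of a structured program: the letter read last and two flags. -/
structure Reg where
  /-- the letter read last -/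
  cur : Option Letter
  /-- first flag -/
  flag : Bool
  /-- second flag -/
  aux : Bool
  deriving Fintype

/-- Structured programs. The instructions `give`, `call`, `take` hand a letter to a subroutine, run
it, and take a letter from its output. -/
inductive Prog
  | load (f : Reg → Reg)
  | push (k : Stack) (f : Reg → Letter)
  | pop (k : Stack)
  | give (f : Reg → Letter)
  | take
  | call
  | seq (p q : Prog)
  | ite (b : Reg → Bool) (p q : Prog)
  | loop (b : Reg → Bool) (p : Prog)

infixr:60 ";;" => Prog.seq

section Semantics

variable (T : TM2ComputableAux Letter Letter)

/-- The memory of a structured program with subroutine `T`. -/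
structure Mem where
  /-- registers -/
  reg : Reg
  /-- work stacks -/
  store : Store
  /-- stacks of the subroutine -/
  stk : ∀ j, List (T.tm.Γ j)

/-- Big-step semantics of structured programs; the number counts the jumps. -/
inductive Exec : Prog → Mem T → Mem T → ℕ → Prop
  | load (f) (m : Mem T) : Exec (.load f) m { m with reg := f m.reg } 0
  | push (k f) (m : Mem T) :
      Exec (.push k f) m { m with store := m.store.set k (f m.reg :: m.store.get k) } 0
  | pop (k) (m : Mem T) :
      Exec (.pop k) m
        ⟨{ m.reg with cur := (m.store.get k).head? }, m.store.set k (m.store.get k).tail, m.stk⟩ 0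
  | give (f) (m : Mem T) :
      Exec (.give f) m ⟨m.reg, m.store, Function.update m.stk T.tm.k₀
        (T.inputAlphabet.symm (f m.reg) :: m.stk T.tm.k₀)⟩ 0
  | take (m : Mem T) :
      Exec .take m ⟨{ m.reg with cur := (m.stk T.tm.k₁).head?.map T.outputAlphabet },
        m.store, Function.update m.stk T.tm.k₁ (m.stk T.tm.k₁).tail⟩ 0
  | call (n) (m : Mem T) (S : ∀ j, List (T.tm.Γ j))
      (h : (flip bind (TM2.step T.tm.m))^[n]
        (some (⟨some T.tm.main, T.tm.initialState, m.stk⟩ : TM2.Cfg T.tm.Γ T.tm.Λ T.tm.σ)) =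
          some ⟨none, T.tm.initialState, S⟩) :
      Exec .call m { m with stk := S } n
  | seq {p q m₁ m₂ m₃ c d} : Exec p m₁ m₂ c → Exec q m₂ m₃ d → Exec (p ;; q) m₁ m₃ (c + d)
  | ite_true {b p q m₁ m₂ c} : b m₁.reg = true → Exec p m₁ m₂ c → Exec (.ite b p q) m₁ m₂ c
  | ite_false {b p q m₁ m₂ c} : b m₁.reg = false → Exec q m₁ m₂ c → Exec (.ite b p q) m₁ m₂ c
  | loop_exit {b p} {m : Mem T} : b m.reg = false → Exec (.loop b p) m m 1
  | loop_step {b p m₁ m₂ m₃ c d} : b m₁.reg = true → Exec p m₁ m₂ c → Exec (.loop b p) m₂ m₃ d →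
      Exec (.loop b p) m₁ m₃ (1 + (c + d))

/-! ### Compilation to a multi-stack machine -/

/-- The alphabets of the stacks of the compiled machine. -/
abbrev Alph : Stack ⊕ T.tm.K → Type
  | .inl _ => Letter
  | .inr j => T.tm.Γ j

/-- The statements of the compiled machine. -/
abbrev Code (Λ : Type) : Type := TM2.Stmt (Alph T) Λ (Reg × T.tm.σ)

/-- The stacks of the compiled machine. -/
def jointStk (s : Store) (S : ∀ j, List (T.tm.Γ j)) : ∀ k, List (Alph T k)
  | .inl k => s.get k
  | .inr j => S j

/-- A statement of the subroutine as part of the compiled machine: it continues with `k` where the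
subroutine halts. -/
def embedStmt {Λ : Type} (e : T.tm.Λ → Λ) (k : Code T Λ) :
    TM2.Stmt T.tm.Γ T.tm.Λ T.tm.σ → Code T Λ
  | .push j f q => .push (.inr j) (fun v => f v.2) (embedStmt e k q)
  | .peek j f q => .peek (.inr j) (fun v x => (v.1, f v.2 x)) (embedStmt e k q)
  | .pop j f q => .pop (.inr j) (fun v x => (v.1, f v.2 x)) (embedStmt e k q)
  | .load f q => .load (fun v => (v.1, f v.2)) (embedStmt e k q)
  | .branch f q₁ q₂ => .branch (fun v => f v.2) (embedStmt e k q₁) (embedStmt e k q₂)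
  | .goto f => .goto (fun v => e (f v.2))
  | .halt => k

/-- The labels that a program needs. -/
def Prog.Label : Prog → Type
  | .load _ | .push _ _ | .pop _ | .give _ | .take => Empty
  | .call => T.tm.Λ
  | .seq p q | .ite _ p q => p.Label ⊕ q.Label
  | .loop _ p => Option p.Label

/-- There are finitely many labels. -/
@[reducible] def Prog.fintypeLabel : ∀ p : Prog, Fintype (p.Label T)
  | .load _ | .push _ _ | .pop _ | .give _ | .take => inferInstanceAs (Fintype Empty)
  | .call => T.tm.ΛFin
  | .seq p q | .ite _ p q =>
    letI := p.fintypeLabel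
    letI := q.fintypeLabel
    inferInstanceAs (Fintype (p.Label T ⊕ q.Label T))
  | .loop _ p =>
    letI := p.fintypeLabel
    inferInstanceAs (Fintype (Option (p.Label T)))

/-- The statement that starts `p` and then continues with `k`. -/
def Prog.code {Λ : Type} : ∀ p : Prog, (p.Label T → Λ) → Code T Λ → Code T Λ
  | .load f, _, k => .load (fun v => (f v.1, v.2)) k
  | .push i f, _, k => .push (.inl i) (fun v => f v.1) k
  | .pop i, _, k => .pop (.inl i) (fun v x => ({ v.1 with cur := x }, v.2)) k
  | .give f, _, k => .push (.inr T.tm.k₀) (fun v => T.inputAlphabet.symm (f v.1)) k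
  | .take, _, k =>
    .pop (.inr T.tm.k₁) (fun v x => ({ v.1 with cur := x.map T.outputAlphabet }, v.2)) k
  | .call, e, _ => .goto (fun _ => e T.tm.main)
  | .seq p q, e, k => p.code (e ∘ Sum.inl) (q.code (e ∘ Sum.inr) k)
  | .ite b p q, e, k => .branch (fun v => b v.1) (p.code (e ∘ Sum.inl) k) (q.code (e ∘ Sum.inr) k)
  | .loop _ _, e, _ => .goto (fun _ => e none)

/-- The statements at the labels of `p`, if `p` is followed by `k`. -/
def Prog.table {Λ : Type} : ∀ p : Prog, (p.Label T → Λ) → Code T Λ → p.Label T → Code T Λ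
  | .load _, _, _ | .push _ _, _, _ | .pop _, _, _ | .give _, _, _ | .take, _, _ => Empty.elim
  | .call, e, k => fun l => embedStmt T e k (T.tm.m l)
  | .seq p q, e, k =>
    Sum.elim (p.table (e ∘ Sum.inl) (q.code T (e ∘ Sum.inr) k)) (q.table (e ∘ Sum.inr) k)
  | .ite _ p q, e, k => Sum.elim (p.table (e ∘ Sum.inl) k) (q.table (e ∘ Sum.inr) k)
  | .loop b p, e, k => fun l =>
    Option.elim l (.branch (fun v => b v.1)
      (p.code T (e ∘ some) (.goto fun _ => e none)) k)
      (p.table (e ∘ some) (.goto fun _ => e none))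

variable {T}

theorem update_jointStk_inl (s : Store) (S : ∀ j, List (T.tm.Γ j)) (k : Stack) (w : List Letter) :
    Function.update (jointStk T s S) (.inl k) w = jointStk T (s.set k w) S := by
  funext j
  cases j with
  | inl j =>
    simp only [jointStk, Store.get_set]
    by_cases h : j = k
    · subst h; simp
    · rw [Function.update_of_ne (by simpa using h), Function.update_of_ne h]; rfl
  | inr j => rw [Function.update_of_ne (by simp)]; rfl

theorem update_jointStk_inr (s : Store) (S : ∀ j, List (T.tm.Γ j)) (k : T.tm.K)
    (w : List (T.tm.Γ k)) :
    Function.update (jointStk T s S) (.inr k) w = jointStk T s (Function.update S k w) := by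
  funext j
  cases j with
  | inl j => rw [Function.update_of_ne (by simp)]; rfl
  | inr j =>
    by_cases h : j = k
    · subst h; simp [jointStk]
    · rw [Function.update_of_ne (by simpa using h)]
      simp [jointStk, Function.update_of_ne h]

/-- The configuration of the compiled machine that corresponds to a configuration of the
subroutine. -/
def embedCfg {Λ : Type} (e : T.tm.Λ → Λ) (k : Code T Λ) (r : Reg) (s : Store)
    (c : TM2.Cfg T.tm.Γ T.tm.Λ T.tm.σ) : TM2.Cfg (Alph T) Λ (Reg × T.tm.σ) :=
  match c.l with
  | some l => ⟨some (e l), (r, c.var), jointStk T s c.stk⟩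
  | none => TM2.stepAux k (r, c.var) (jointStk T s c.stk)

/-- The embedding only touches the subroutine's own stacks and state. Where the subroutine would
halt, the continuation `k` runs within the same machine step, which is why `embedCfg` interprets a
halted configuration by executing `k`. -/
theorem stepAux_embedStmt {Λ : Type} (e : T.tm.Λ → Λ) (k : Code T Λ) (r : Reg) (s : Store)
    (q : TM2.Stmt T.tm.Γ T.tm.Λ T.tm.σ) (v : T.tm.σ) (S : ∀ j, List (T.tm.Γ j)) :
    TM2.stepAux (embedStmt T e k q) (r, v) (jointStk T s S) =
      embedCfg e k r s (TM2.stepAux q v S) := by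
  induction q generalizing v S with
  | push j f q ih => simp only [embedStmt, TM2.stepAux, update_jointStk_inr, ← ih]; rfl
  | peek j f q ih => simp only [embedStmt, TM2.stepAux, ← ih]; rfl
  | pop j f q ih => simp only [embedStmt, TM2.stepAux, update_jointStk_inr, ← ih]; rfl
  | load f q ih => simp only [embedStmt, TM2.stepAux, ← ih]
  | branch f q₁ q₂ ih₁ ih₂ =>
    simp only [embedStmt, TM2.stepAux, ih₁, ih₂]
    cases f v <;> rfl
  | goto f => rfl
  | halt => rfl

/-- Simulation is step by step, and the return from the subroutine is free, so a call costs exactly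
the running time of the subroutine. -/
theorem iterate_embedCfg {Λ : Type} (e : T.tm.Λ → Λ) (k : Code T Λ) (r : Reg) (s : Store)
    (M : Λ → Code T Λ) (hM : ∀ l, M (e l) = embedStmt T e k (T.tm.m l)) (n : ℕ)
    (c c' : TM2.Cfg T.tm.Γ T.tm.Λ T.tm.σ)
    (h : (flip bind (TM2.step T.tm.m))^[n] (some c) = some c') :
    (flip bind (TM2.step M))^[n] (some (embedCfg e k r s c)) = some (embedCfg e k r s c') := by
  induction n generalizing c' with
  | zero => simp only [Function.iterate_zero, id, Option.some.injEq] at h ⊢; rw [h]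
  | succ n ih =>
    rw [Function.iterate_succ_apply'] at h ⊢
    obtain ⟨d, hd⟩ : ∃ d, (flip bind (TM2.step T.tm.m))^[n] (some c) = some d := by
      cases hc : (flip bind (TM2.step T.tm.m))^[n] (some c) with
      | none => rw [hc] at h; simp [flip] at h
      | some d => exact ⟨d, rfl⟩
    rw [ih d hd]
    rw [hd] at h
    obtain ⟨_ | l, v, S⟩ := d
    -- A halted configuration has no successor, so it cannot occur before the last step.
    · simp [flip] at h
    · simp only [flip, Option.bind_eq_bind, Option.bind_some, TM2.step, Option.some.injEq] at h
      simp only [flip, Option.bind_eq_bind, Option.bind_some, embedCfg, TM2.step, hM,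
        stepAux_embedStmt, h]

/-- The compiled code follows the semantics of the program. -/
theorem Exec.sound {p : Prog} {m m' : Mem T} {n : ℕ} (h : Exec T p m m' n) {Λ : Type}
    (M : Λ → Code T Λ) (e : p.Label T → Λ) (k : Code T Λ) (hM : ∀ l, M (e l) = p.table T e k l) :
    (flip bind (TM2.step M))^[n]
      (some (TM2.stepAux (p.code T e k) (m.reg, T.tm.initialState) (jointStk T m.store m.stk))) =
    some (TM2.stepAux k (m'.reg, T.tm.initialState) (jointStk T m'.store m'.stk)) := by
  induction h generalizing k with
  | load f m => rfl
  | push i f m => 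
    simp only [Prog.code, TM2.stepAux, update_jointStk_inl]; rfl
  | pop i m => simp only [Prog.code, TM2.stepAux, update_jointStk_inl]; rfl
  | give f m => simp only [Prog.code, TM2.stepAux, update_jointStk_inr]; rfl
  | take m => simp only [Prog.code, TM2.stepAux, update_jointStk_inr]; rfl
  | call n m S h => exact iterate_embedCfg e k m.reg m.store M hM n _ _ h
  | @seq p q m₁ m₂ m₃ c d h₁ h₂ ih₁ ih₂ =>
    rw [add_comm, Function.iterate_add_apply]
    exact (congrArg _ (ih₁ (e ∘ Sum.inl) _ fun l => hM (.inl l))).trans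
      (ih₂ (e ∘ Sum.inr) k fun l => hM (.inr l))
  | @ite_true b p q m₁ m₂ c hb h ih =>
    simp only [Prog.code, TM2.stepAux, hb, cond_true]
    exact ih _ _ fun l => hM (.inl l)
  | @ite_false b p q m₁ m₂ c hb h ih =>
    simp only [Prog.code, TM2.stepAux, hb, cond_false]
    exact ih _ _ fun l => hM (.inr l)
  | @loop_exit b p m hb =>
    have h0 := hM none
    simp only [Prog.table, Option.elim] at h0
    simp [Prog.code, TM2.stepAux, flip, TM2.step, h0, hb]
  | @loop_step b p m₁ m₂ m₃ c d hb h₁ h₂ ih₁ ih₂ =>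
    have h0 := hM none
    simp only [Prog.table, Option.elim] at h0
    -- The code of a loop is a jump to its head, and the body ends with the same jump. One step
    -- evaluates the test and begins the body.
    have step : (flip bind (TM2.step M))^[1] (some (TM2.stepAux ((Prog.loop b p).code T e k)
        (m₁.reg, T.tm.initialState) (jointStk T m₁.store m₁.stk))) =
        some (TM2.stepAux (p.code T (e ∘ some) (.goto fun _ => e none))
          (m₁.reg, T.tm.initialState) (jointStk T m₁.store m₁.stk)) := by
      simp [Prog.code, TM2.stepAux, flip, TM2.step, h0, hb]
    rw [show 1 + (c + d) = d + (c + 1) by ring, Function.iterate_add_apply,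
      Function.iterate_add_apply, step]
    exact (congrArg _ (ih₁ (e ∘ some) _ fun l => hM (some l))).trans (ih₂ e k hM)

/-- The empty store. -/
def Store.empty : Store := ⟨[], [], [], [], [], [], [], [], [], [], [], [], [], []⟩

/-- The initial contents of the registers. -/
def Reg.start : Reg := ⟨none, false, false⟩

variable (T) in
/-- The machine that runs a structured program with subroutine `T`. -/
def Prog.machine (p : Prog) : FinTM2 :=
  letI := p.fintypeLabel T
  letI := T.tm.kFin
  letI := T.tm.σFin
  { K := Stack ⊕ T.tm.K
    k₀ := .inl .inp
    k₁ := .inl .out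
    Γ := Alph T
    Λ := Option (p.Label T)
    main := none
    σ := Reg × T.tm.σ
    initialState := (Reg.start, T.tm.initialState)
    Γk₀Fin := inferInstanceAs (Fintype Letter)
    m := fun l => l.elim (p.code T some .halt) (p.table T some .halt) }

variable (T) in
/-- The machine of a structured program, with its alphabets. -/
def Prog.computer (p : Prog) : TM2ComputableAux Letter Letter :=
  ⟨p.machine T, Equiv.refl Letter, Equiv.refl Letter⟩

/-- The extra step leads from the main label into the code. A halting configuration in the sense of
`haltList` has the initial state and no content outside the output stack, so the program has to
reset its registers and clear all other stacks. -/
theorem Exec.outputsInTime {p : Prog} {w v : List Letter} {n N : ℕ}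
    (h : Exec T p ⟨Reg.start, { Store.empty with inp := w }, fun _ => []⟩
      ⟨Reg.start, { Store.empty with out := v }, fun _ => []⟩ n) (hn : n + 1 ≤ N) :
    Nonempty (TM2OutputsInTime (p.computer T).tm (w.map (p.computer T).inputAlphabet.symm)
      (some (v.map (p.computer T).outputAlphabet.symm)) N) := by
  refine ⟨⟨⟨n + 1, ?_⟩, hn⟩⟩
  have hs := h.sound (Λ := Option (p.Label T))
    (fun l => l.elim (p.code T some .halt) (p.table T some .halt)) some .halt fun l => rfl
  have h0 : initList (p.computer T).tm (w.map (p.computer T).inputAlphabet.symm) =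
      (⟨some none, (Reg.start, T.tm.initialState),
        jointStk T { Store.empty with inp := w } fun _ => []⟩ :
          TM2.Cfg (Alph T) (Option (p.Label T)) (Reg × T.tm.σ)) := by
    rw [initList, show (w.map (p.computer T).inputAlphabet.symm) = w from List.map_id w]
    congr 1
    funext k
    obtain k | k := k
    · cases k <;> rfl
    · rfl
  have h1 : haltList (p.computer T).tm (v.map (p.computer T).outputAlphabet.symm) =
      (⟨none, (Reg.start, T.tm.initialState),
        jointStk T { Store.empty with out := v } fun _ => []⟩ :
          TM2.Cfg (Alph T) (Option (p.Label T)) (Reg × T.tm.σ)) := by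
    rw [haltList, show (v.map (p.computer T).outputAlphabet.symm) = v from List.map_id v]
    congr 1
    funext k
    obtain k | k := k
    · cases k <;> rfl
    · rfl
  rw [Function.iterate_succ_apply, h0, Option.map_some, h1]
  exact hs

end Semantics

/-! ### Program logic -/

/-- `p` leads from registers `r` and work stacks `s` to `r'` and `s'` with at most `c` jumps, and
leaves the stacks of the subroutine as they are. -/
def Runs (p : Prog) (r : Reg) (s : Store) (r' : Reg) (s' : Store) (c : ℕ) : Prop :=
  ∀ (T : TM2ComputableAux Letter Letter) (S : ∀ j, List (T.tm.Γ j)),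
    ∃ n ≤ c, Exec T p ⟨r, s, S⟩ ⟨r', s', S⟩ n

namespace Runs

variable {p q : Prog} {r r₁ r₂ r₃ : Reg} {s s₁ s₂ s₃ : Store} {c d : ℕ}

theorem mono (h : Runs p r s r₁ s₁ c) (hcd : c ≤ d) : Runs p r s r₁ s₁ d := fun T S =>
  let ⟨n, hn, he⟩ := h T S
  ⟨n, hn.trans hcd, he⟩

theorem of_eq (h : Runs p r s r₁ s₁ c) (hr : r₁ = r₂) (hs : s₁ = s₂) (hcd : c ≤ d) :
    Runs p r s r₂ s₂ d :=
  hr ▸ hs ▸ h.mono hcd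

theorem of_eq_left (h : Runs p r s r₁ s₁ c) (hr : r = r₂) (hs : s = s₂) :
    Runs p r₂ s₂ r₁ s₁ c :=
  hr ▸ hs ▸ h

theorem seq (h : Runs p r s r₁ s₁ c) (h' : Runs q r₁ s₁ r₂ s₂ d) :
    Runs (p ;; q) r s r₂ s₂ (c + d) := fun T S =>
  let ⟨_, hn, he⟩ := h T S
  let ⟨_, hn', he'⟩ := h' T S
  ⟨_, add_le_add hn hn', he.seq he'⟩

theorem seq_of_eq (h : Runs p r s r₁ s₁ c) (h' : Runs q r₂ s₂ r₃ s₃ d) (hr : r₁ = r₂)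
    (hs : s₁ = s₂) : Runs (p ;; q) r s r₃ s₃ (c + d) :=
  h.seq (hr ▸ hs ▸ h')

theorem ite_true {b : Reg → Bool} (hb : b r = true) (h : Runs p r s r₁ s₁ c) :
    Runs (.ite b p q) r s r₁ s₁ c := fun T S =>
  let ⟨_, hn, he⟩ := h T S
  ⟨_, hn, .ite_true hb he⟩

theorem ite_false {b : Reg → Bool} (hb : b r = false) (h : Runs q r s r₁ s₁ c) :
    Runs (.ite b p q) r s r₁ s₁ c := fun T S =>
  let ⟨_, hn, he⟩ := h T S
  ⟨_, hn, .ite_false hb he⟩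

theorem load (f : Reg → Reg) : Runs (.load f) r s (f r) s 0 := fun _ _ => ⟨_, le_rfl, .load _ _⟩

theorem push (k : Stack) (f : Reg → Letter) :
    Runs (.push k f) r s r (s.set k (f r :: s.get k)) 0 := fun _ _ => ⟨_, le_rfl, .push _ _ _⟩

theorem pop (k : Stack) :
    Runs (.pop k) r s { r with cur := (s.get k).head? } (s.set k (s.get k).tail) 0 :=
  fun _ _ => ⟨_, le_rfl, .pop _ _⟩

end Runs

namespace Prog

/-- Does the register hold the letter `a`? -/
def isCur (a : Letter) (r : Reg) : Bool := decide (r.cur = some a)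

/-- Do nothing. -/
def skip : Prog := .load id

/-- Push the letter read last. -/
def pushCur (k : Stack) : Prog := .push k fun r => r.cur.getD .bot

/-- Push a fixed letter. -/
def pushLetter (k : Stack) (a : Letter) : Prog := .push k fun _ => a

/-- Empty the stack `k` letter by letter and execute `p` after each letter. -/
def forPop (k : Stack) (p : Prog) : Prog :=
  .pop k ;; .loop (fun r => r.cur.isSome) (p ;; .pop k)

/-- Execute a program for each element of a fixed list. -/
def forList {α : Type} (l : List α) (f : α → Prog) : Prog := l.foldr (fun a p => f a ;; p) skip

/-- Push a fixed word. -/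
def pushWord (k : Stack) (w : List Letter) : Prog := forList w (pushLetter k)

/-- Move the content of a stack to another one. -/
def move (k j : Stack) : Prog := forPop k (pushCur j)

/-- Empty a stack. -/
def clear (k : Stack) : Prog := forPop k skip

end Prog

open Prog

theorem Runs.skip {r : Reg} {s : Store} : Runs skip r s r s 0 := Runs.load id

section

variable {T : TM2ComputableAux Letter Letter} {k : Stack} {p : Prog}

/-- The pop that starts the remaining `forPop` also serves as the pop that ends the first pass
through the body. Hence the given execution `h'` is cut after its pop and reassembled. -/
theorem Exec.forPop_cons {m m₁ m₂ : Mem T} {a : Letter} {v : List Letter} {c d : ℕ}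
    (hs : m.store.get k = a :: v)
    (h : Exec T p ⟨{ m.reg with cur := some a }, m.store.set k v, m.stk⟩ m₁ c)
    (h' : Exec T (forPop k p) m₁ m₂ d) : Exec T (forPop k p) m m₂ (c + d + 1) := by
  cases h' with
  | @seq _ _ _ m' _ x y h₁ h₂ =>
    rw [show c + (x + y) + 1 = 0 + (1 + ((c + x) + y)) by omega]
    refine Exec.seq (Exec.pop k _) (Exec.loop_step ?_ (m₂ := m') ?_ h₂)
    · simp [hs]
    · refine Exec.seq (m₂ := m₁) ?_ h₁
      simpa [hs] using h

theorem Exec.forPop_nil {m : Mem T} (hs : m.store.get k = []) :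
    Exec T (forPop k p) m { m with reg := { m.reg with cur := none } } 1 := by
  rw [← zero_add 1]
  refine Exec.seq (Exec.pop k _) ?_
  have : m.store.set k [] = m.store := by rw [← hs, Store.set_get]
  simp only [hs, List.head?_nil, List.tail_nil, this]
  exact Exec.loop_exit rfl

theorem Runs.forPop_cons {r r₁ r₂ : Reg} {s s₁ s₂ : Store} {a : Letter}
    {v : List Letter} {c d : ℕ} (hs : s.get k = a :: v)
    (h : Runs p { r with cur := some a } (s.set k v) r₁ s₁ c)
    (h' : Runs (forPop k p) r₁ s₁ r₂ s₂ d) : Runs (forPop k p) r s r₂ s₂ (c + d + 1) := fun T S =>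
  let ⟨_, hn, he⟩ := h T S
  let ⟨_, hm, he'⟩ := h' T S
  ⟨_, by omega, Exec.forPop_cons hs he he'⟩

theorem Runs.forPop_nil {r : Reg} {s : Store} (hs : s.get k = []) :
    Runs (forPop k p) r s { r with cur := none } s 1 := fun _ _ => ⟨1, le_rfl, Exec.forPop_nil hs⟩

end

/-- The first instruction overwrites the letter read last. -/
theorem Runs.forPop_cur {k : Stack} {p : Prog} {r r' : Reg} {s s' : Store} {c : ℕ}
    {x : Option Letter} (h : Runs (forPop k p) r s r' s' c) :
    Runs (forPop k p) { r with cur := x } s r' s' c := by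
  intro T S
  obtain ⟨n, hn, he⟩ := h T S
  refine ⟨n, hn, ?_⟩
  cases he with
  | seq h₁ h₂ =>
    cases h₁
    exact Exec.seq (Exec.pop k _) h₂

/-- The loop `forPop k p` consumes the top part `w` of the stack `k`. -/
def Iter (k : Stack) (p : Prog) (w : List Letter) (r : Reg) (s : Store) (r' : Reg) (s' : Store)
    (c : ℕ) : Prop :=
  ∀ v r'' s'' d, Runs (forPop k p) r' (s'.set k v) r'' s'' d →
    Runs (forPop k p) r (s.set k (w ++ v)) r'' s'' (c + d)

namespace Iter

variable {k : Stack} {p : Prog} {v w : List Letter} {r r₁ r₂ : Reg} {s s₁ s₂ : Store} {c d : ℕ}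

theorem nil : Iter k p [] r s r s 0 := fun v r'' s'' d h => by simpa using h

theorem mono (h : Iter k p w r s r₁ s₁ c) (hcd : c ≤ d) : Iter k p w r s r₁ s₁ d :=
  fun v r'' s'' d' h' => (h v r'' s'' d' h').mono (by omega)

/-- Since `Iter` quantifies over the rest of the stack and over what the loop does afterwards,
concatenation of words is composition. -/
theorem append (h : Iter k p v r s r₁ s₁ c) (h' : Iter k p w r₁ s₁ r₂ s₂ d) :
    Iter k p (v ++ w) r s r₂ s₂ (c + d) := fun u r'' s'' d' hd => by
  have := h (w ++ u) r'' s'' _ (h' u r'' s'' d' hd)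
  rwa [List.append_assoc, add_assoc]

/-- The letter register is free after the body, because the next pop overwrites it. -/
theorem single {a : Letter}
    (h : ∀ v, ∃ x, Runs p { r with cur := some a } (s.set k v) { r₁ with cur := x }
      (s₁.set k v) c) :
    Iter k p [a] r s r₁ s₁ (c + 1) := by
  intro v r'' s'' d hd
  obtain ⟨x, hx⟩ := h v
  refine (Runs.forPop_cons (a := a) (v := v) (by simp) (by simpa using hx)
    (Runs.forPop_cur hd)).mono (by omega)

theorem cons {a : Letter} (h' : Iter k p w r₁ s₁ r₂ s₂ d)
    (h : ∀ v, ∃ x, Runs p { r with cur := some a } (s.set k v) { r₁ with cur := x }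
      (s₁.set k v) c) :
    Iter k p (a :: w) r s r₂ s₂ (c + 1 + d) :=
  (single h).append h'

theorem of_eq (h : Iter k p w r s r₁ s₁ c) (hr : r₁ = r₂) (hs : s₁ = s₂) (hcd : c ≤ d) :
    Iter k p w r s r₂ s₂ d :=
  hr ▸ hs ▸ h.mono hcd

theorem finish (h : Iter k p w r s r₁ s₁ c) :
    Runs (forPop k p) r (s.set k w) { r₁ with cur := none } (s₁.set k []) (c + 1) := by
  have := h [] { r₁ with cur := none } (s₁.set k []) 1 ?_
  · simpa using this
  · exact Runs.forPop_nil (by simp)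

/-- Consume a word that consists of `n` parts. -/
theorem ofFn {n : ℕ} {w : Fin n → List Letter} (R : ℕ → Reg) (S : ℕ → Store)
    (h : ∀ j : Fin n, Iter k p (w j) (R j) (S j) (R (j + 1)) (S (j + 1)) c) :
    Iter k p (List.ofFn w).flatten (R 0) (S 0) (R n) (S n) (n * c) := by
  induction n with
  | zero => simpa using nil
  | succ n ih =>
    rw [List.ofFn_succ', List.concat_eq_append, List.flatten_append, List.flatten_singleton,
      Nat.succ_mul]
    exact (ih fun j => h j.castSucc).append (h (Fin.last n))

/-- Consume a word letter by letter. -/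
theorem ofFn_letter {n : ℕ} {w : Fin n → Letter} (R : ℕ → Reg) (S : ℕ → Store)
    (h : ∀ (j : Fin n) v, ∃ x, Runs p { R j with cur := some (w j) } ((S j).set k v)
      { R (j + 1) with cur := x } ((S (j + 1)).set k v) c) :
    Iter k p (List.ofFn w) (R 0) (S 0) (R n) (S n) (n * (c + 1)) := by
  have := ofFn (w := fun j => [w j]) R S fun j => single (h j)
  rwa [show (List.ofFn fun j => [w j]) = (List.ofFn w).map fun a => [a] by
    simp [List.map_ofFn, Function.comp_def], ← List.flatMap_def, List.flatMap_singleton'] at this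

end Iter

theorem take_ofFn_succ {α : Type} {n : ℕ} (f : Fin n → α) (j : Fin n) :
    (List.ofFn f).take (j + 1) = (List.ofFn f).take j ++ [f j] := by
  rw [List.take_add_one]
  simp

theorem take_ofFn_self {α : Type} {n : ℕ} (f : Fin n → α) :
    (List.ofFn f).take n = List.ofFn f :=
  List.take_of_length_le (by simp)

namespace Runs

variable {r : Reg} {s : Store}

theorem pushCur {k : Stack} {a : Letter} (h : r.cur = some a) :
    Runs (pushCur k) r s r (s.set k (a :: s.get k)) 0 := by
  have := Runs.push (r := r) (s := s) k fun r => r.cur.getD .bot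
  simp only [h, Option.getD_some] at this
  exact this

theorem move {k j : Stack} (h : k ≠ j) :
    Runs (move k j) r s { r with cur := none }
      ((s.set j ((s.get k).reverse ++ s.get j)).set k []) ((s.get k).length + 1) := by
  have key : ∀ (w : List Letter) (s : Store),
      Iter k (Prog.pushCur j) w r s r (s.set j (w.reverse ++ s.get j)) w.length := by
    intro w
    induction w with
    | nil => intro s; simpa using Iter.nil
    | cons a w ih =>
      intro s
      have := Iter.append (k := k) (p := Prog.pushCur j) (v := [a]) (r := r) (s := s) (c := 1)
        (Iter.single (c := 0) fun v => ⟨some a, ?_⟩) (ih (s.set j (a :: s.get j)))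
      · simpa [add_comm] using this
      · have := Runs.pushCur (r := { r with cur := some a }) (s := s.set k v) (k := j) rfl
        rwa [Store.get_set_of_ne _ (Ne.symm h), Store.set_comm _ h] at this
  have := (key (s.get k) s).finish
  rwa [Store.set_get] at this

theorem clear {k : Stack} :
    Runs (clear k) r s { r with cur := none } (s.set k []) ((s.get k).length + 1) := by
  have key : ∀ w : List Letter, Iter k Prog.skip w r s r s w.length := by
    intro w
    induction w with
    | nil => exact Iter.nil
    | cons a w ih =>
      have := Iter.append (k := k) (p := Prog.skip) (v := [a]) (r := r) (s := s) (c := 1)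
        (Iter.single (c := 0) fun v => ⟨_, Runs.skip⟩) ih
      simpa [add_comm] using this
  have := (key (s.get k)).finish
  rwa [Store.set_get] at this

theorem pushWord {k : Stack} (w : List Letter) :
    Runs (pushWord k w) r s r (s.set k (w.reverse ++ s.get k)) 0 := by
  induction w generalizing s with
  | nil => exact (Store.set_get s k).symm ▸ Runs.skip
  | cons a w ih =>
    have := Runs.seq (Runs.push (r := r) (s := s) k fun _ => a) ih
    simp only [Store.get_set_self, Store.set_set] at this
    rw [List.reverse_cons, List.append_assoc]
    exact this

theorem forList {α : Type} {f : α → Prog} {R : List α → Reg} {S : List α → Store} {c : ℕ}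
    (l : List α)
    (h : ∀ l₁ a l₂, l = l₁ ++ a :: l₂ → Runs (f a) (R l₁) (S l₁) (R (l₁ ++ [a])) (S (l₁ ++ [a])) c) :
    Runs (forList l f) (R []) (S []) (R l) (S l) (l.length * c) := by
  suffices ∀ l₁ l₂, l = l₁ ++ l₂ → Runs (Prog.forList l₂ f) (R l₁) (S l₁) (R l) (S l) (l₂.length * c)
    from this [] l rfl
  intro l₁ l₂ hl
  induction l₂ generalizing l₁ with
  | nil => simp only [List.append_nil] at hl; subst hl; exact Runs.skip.mono (Nat.zero_le _)
  | cons a l₂ ih =>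
    have := Runs.seq (h l₁ a l₂ hl) (ih (l₁ ++ [a]) (by simpa using hl))
    exact this.mono (by simp [Nat.succ_mul, add_comm])

end Runs

/-! ### Marking the diagonal of the adjacency matrix -/

/-- The letter for an entry of the adjacency matrix, with the diagonal marked by `⊥`. -/
def cell {n : ℕ} (adj : Fin n → Fin n → Bool) (i j : Fin n) : Letter :=
  if i = j then .bot else .bit (adj i j)

/-- A row of the marked adjacency matrix. -/
def markedRow {n : ℕ} (adj : Fin n → Fin n → Bool) (i : Fin n) : List Letter :=
  List.ofFn (cell adj i) ++ [.newline]

/-- The marked adjacency matrix. -/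
def markedWord {n : ℕ} (adj : Fin n → Fin n → Bool) : List Letter :=
  (List.ofFn (markedRow adj)).flatten

/-- A number in unary. -/
def unary (n : ℕ) : List Letter := List.replicate n .comma

@[simp] theorem unary_zero : unary 0 = [] := rfl

theorem unary_succ (n : ℕ) : unary (n + 1) = .comma :: unary n := rfl

@[simp] theorem length_unary (n : ℕ) : (unary n).length = n := List.length_replicate

@[simp] theorem reverse_unary (n : ℕ) : (unary n).reverse = unary n := List.reverse_replicate

namespace Prog

/-- Copy a letter of the adjacency matrix to the stack `graph`, without commas and with the diagonal
marked; the stack `count` holds the number of rows read so far. -/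
def markLetter : Prog :=
  .ite (isCur .newline)
    (pushCur .graph ;; move .count' .count ;; pushLetter .count .comma ;;
      .load fun r => { r with flag := false })
    (.ite (isCur .comma) skip
      (pushCur .graph ;; .ite (fun r => r.flag) skip
        (.pop .count ;; .ite (fun r => r.cur.isNone)
          (.pop .graph ;; pushLetter .graph .bot ;; .load fun r => { r with flag := true })
          (pushCur .count'))))

/-- Read the adjacency matrix. -/
def mark : Prog := forPop .inp markLetter

end Prog

theorem length_markedWord {n : ℕ} (adj : Fin n → Fin n → Bool) :
    (markedWord adj).length = n * (n + 1) := by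
  simp [markedWord, markedRow, List.length_flatten, List.map_ofFn, Function.comp_def]

/-- The diagonal is located by counting: in row `i`, each entry moves one letter from `count` to
`count'`, until `count` is found empty, which happens exactly at column `i`. From then on the flag
records that the diagonal has been passed. -/
theorem iter_markLetter_entry {n : ℕ} (adj : Fin n → Fin n → Bool) (i j : Fin n) (s : Store)
    (g : List Letter) :
    Iter .inp markLetter ([.bit (adj i j)] ++ [.comma]) ⟨none, decide ((i : ℕ) < j), false⟩
      { s with
        graph := ((List.ofFn (cell adj i)).take j).reverse ++ g
        count := unary (i - j), count' := unary (min i j) }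
      ⟨none, decide ((i : ℕ) < j + 1), false⟩
      { s with
        graph := ((List.ofFn (cell adj i)).take (j + 1)).reverse ++ g
        count := unary (i - (j + 1)), count' := unary (min i (j + 1)) } 2 := by
  refine Iter.append (c := 1) (d := 1) (Iter.single (c := 0) fun v => ?_) (Iter.single (c := 0)
    fun v => ⟨_, .ite_false rfl (.ite_true rfl .skip)⟩)
  rw [take_ofFn_succ, List.reverse_append, List.reverse_singleton, List.singleton_append,
    List.cons_append]
  rcases lt_trichotomy (i : ℕ) j with h | h | h
  · refine ⟨_, .of_eq (.ite_false rfl (.ite_false rfl (.seq (.pushCur rfl)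
      (.ite_true (by simp [h]) .skip)))) (by simp [h, h.trans (Nat.lt_succ_self _)]; rfl) ?_ le_rfl⟩
    have : cell adj i j = .bit (adj i j) := if_neg (by rintro rfl; omega)
    simp only [Store.set, Store.get, this, Store.mk.injEq, true_and, and_true]
    exact ⟨congrArg _ (by omega), congrArg _ (by omega)⟩
  · obtain rfl : i = j := Fin.ext h
    refine ⟨_, .of_eq (.ite_false rfl (.ite_false rfl (.seq (.pushCur rfl)
      (.ite_false (by simp) (.seq (.pop _) (.ite_true (by simp [Store.get, Store.set])
      (.seq (.pop _) (.seq (.push _ _) (.load _))))))))) (by simp; rfl) ?_ le_rfl⟩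
    have : cell adj i i = .bot := if_pos rfl
    simp only [Store.set, Store.get, this, Store.mk.injEq, true_and, and_true]
    simp
  · obtain ⟨m, hm⟩ : ∃ m, (i : ℕ) - j = m + 1 := ⟨i - j - 1, by omega⟩
    rw [hm, show (i : ℕ) - (j + 1) = m by omega, show min (i : ℕ) (j + 1) = j + 1 by omega,
      show min (i : ℕ) j = j by omega]
    refine ⟨some .comma, .of_eq (.ite_false rfl (.ite_false rfl (.seq (.pushCur rfl)
      (.ite_false (by simpa using h.le) (.seq (.pop _)
      (.ite_false (by simp [Store.get, Store.set, unary_succ])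
      (.pushCur (a := .comma) (by simp [Store.get, Store.set, unary_succ]))))))))
      (by simp [show ¬ (i : ℕ) < j by omega, show ¬ (i : ℕ) < j + 1 by omega, -Fin.val_fin_lt,
        -not_lt, Store.get, Store.set, unary_succ]) ?_ le_rfl⟩
    have : cell adj i j = .bit (adj i j) := if_neg (by rintro rfl; omega)
    simp only [Store.set, Store.get, this, Store.mk.injEq, true_and, and_true]
    simp [unary_succ]

/-- At the end of the row, `count'` holds all `i` letters again. They are moved back and one is
added, so the next diagonal entry is found one column later. -/
theorem iter_markLetter_row {n : ℕ} (adj : Fin n → Fin n → Bool) (i : Fin n) (s : Store)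
    (g : List Letter) :
    Iter .inp markLetter
      ((List.ofFn fun j => [.bit (adj i j)] ++ [.comma]).flatten ++ [.newline])
      ⟨none, false, false⟩ { s with graph := g, count := unary i, count' := [] }
      ⟨none, false, false⟩
      { s with graph := (markedRow adj i).reverse ++ g, count := unary (i + 1), count' := [] }
      (3 * n + 2) := by
  have h1 := Iter.ofFn (fun j => ⟨none, decide ((i : ℕ) < j), false⟩)
    (fun j => { s with
      graph := ((List.ofFn (cell adj i)).take j).reverse ++ g
      count := unary (i - j), count' := unary (min i j) })
    fun j => iter_markLetter_entry adj i j s g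
  simp only [Nat.not_lt_zero, decide_false, List.take_zero, List.reverse_nil, List.nil_append,
    Nat.sub_zero, Nat.min_zero, unary_zero, i.2, decide_true] at h1
  refine (h1.append (Iter.single (r₁ := ⟨none, false, false⟩) (c := n + 1)
    fun v => ⟨_, .of_eq (.ite_true rfl (.seq (.pushCur rfl) (.seq (.move (by decide))
      (.seq (.push _ _) (.load _))))) rfl ?_ ?_⟩)).mono (by omega)
  · simp only [Store.set, Store.get, Store.mk.injEq, true_and, and_true]
    simp [markedRow, unary_succ, i.2.le]
  · simp only [Store.set, Store.get]
    simp

theorem runs_mark {n : ℕ} (adj : Fin n → Fin n → Bool) :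
    Runs mark ⟨none, false, false⟩
      { Store.empty with inp := encodeMatrix (fun b : Bool => [Letter.bit b]) adj }
      ⟨none, false, false⟩
      { Store.empty with graph := (markedWord adj).reverse, count := unary n }
      (n * (3 * n + 2) + 1) := by
  have h := Iter.ofFn (k := .inp) (p := markLetter) (c := 3 * n + 2)
    (w := fun i : Fin n => (List.ofFn fun j => [.bit (adj i j)] ++ [.comma]).flatten ++ [.newline])
    (fun _ => ⟨none, false, false⟩)
    (fun i => { Store.empty with
      graph := ((List.ofFn (markedRow adj)).take i).flatten.reverse
      count := unary i }) fun i => ?_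
  · refine h.finish.of_eq rfl ?_ le_rfl
    simp only [Store.set, Store.mk.injEq, and_true, markedWord]
    rw [List.take_of_length_le (by simp)]
    exact ⟨rfl, rfl⟩
  · rw [take_ofFn_succ, List.flatten_append, List.flatten_singleton, List.reverse_append]
    exact iter_markLetter_row adj i Store.empty _

/-! ### Writing the instance of the matrix problem -/

namespace Prog

/-- Write the word that belongs to the letter read last. -/
def emitEntry (E : Letter → List Letter) : Prog :=
  .ite (isCur .bot) (pushWord .word (E .bot))
    (.ite (isCur (.bit true)) (pushWord .word (E (.bit true))) (pushWord .word (E (.bit false))))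

/-- Write the words that belong to the letters of the stack `row`. -/
def emitRow (E : Letter → List Letter) : Prog :=
  move .row .row' ;; forPop .row' (pushCur .row ;; emitEntry E)

/-- Collect a row of the marked adjacency matrix, and at its end write the words that belong to
it. -/
def emitLetter {α : Type} (l : List α) (E : α → Letter → List Letter) : Prog :=
  pushCur .graph ;; .ite (isCur .newline)
    (forList l (fun b => emitRow (E b)) ;; pushLetter .word .newline ;; clear .row)
    (pushCur .row)

/-- Write a block matrix whose blocks are images of the marked adjacency matrix. -/
def emit {α : Type} (l : List α) (E : α → α → Letter → List Letter) : Prog :=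
  forList l fun a => move .graph .graph' ;; forPop .graph' (emitLetter l (E a))

end Prog

/-- The image of a row under a substitution. -/
def rowImage {n : ℕ} (E : Letter → List Letter) (x : Fin n → Letter) : List Letter :=
  (List.ofFn fun j => E (x j)).flatten

/-- A row of the block matrix. -/
def blockRow {α : Type} {n : ℕ} (l : List α) (E : α → Letter → List Letter) (x : Fin n → Letter) :
    List Letter :=
  (l.map fun b => rowImage (E b) x).flatten ++ [.newline]

/-- The block matrix. -/
def blockMatrix {α : Type} {n : ℕ} (l : List α) (E : α → α → Letter → List Letter)
    (x : Fin n → Fin n → Letter) : List Letter :=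
  (l.map fun a => (List.ofFn fun i => blockRow l (E a) (x i)).flatten).flatten

theorem runs_emitEntry (E : Letter → List Letter) {n : ℕ} (adj : Fin n → Fin n → Bool)
    (i j : Fin n) (r : Reg) (s : Store) (hr : r.cur = some (cell adj i j)) :
    Runs (emitEntry E) r s r { s with word := (E (cell adj i j)).reverse ++ s.word } 0 := by
  unfold cell at hr ⊢
  split_ifs at hr ⊢ with h
  · exact .ite_true (by simp [isCur, hr]) (.pushWord _)
  · refine .ite_false (by simp [isCur, hr]) ?_
    cases hb : adj i j
    · exact .ite_false (by simp [isCur, hr, hb]) (.pushWord _)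
    · exact .ite_true (by simp [isCur, hr, hb]) (.pushWord _)

/-- The stack `row` is rebuilt while it is read, so that the same row can be substituted for the
next block as well. -/
theorem runs_emitRow (E : Letter → List Letter) {n : ℕ} (adj : Fin n → Fin n → Bool)
    (i : Fin n) (r : Reg) (s : Store) (hrow : s.row = (List.ofFn (cell adj i)).reverse)
    (hrow' : s.row' = []) :
    Runs (emitRow E) r s { r with cur := none }
      { s with word := (rowImage E (cell adj i)).reverse ++ s.word } (2 * n + 2) := by
  have h := Iter.ofFn_letter (k := .row') (p := pushCur .row ;; emitEntry E) (c := 0)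
    (w := cell adj i) (fun _ => r)
    (fun j => { s with
      row := ((List.ofFn (cell adj i)).take j).reverse
      word := ((List.ofFn fun j => E (cell adj i j)).take j).flatten.reverse ++ s.word })
    fun j v => ⟨_, .of_eq (.seq (.pushCur rfl) (runs_emitEntry E adj i j _ _ rfl)) rfl ?_ le_rfl⟩
  · rw [take_ofFn_self, take_ofFn_self] at h
    refine (Runs.seq_of_eq (.move (by decide)) h.finish.forPop_cur rfl ?_).of_eq rfl ?_ ?_
    · simp [Store.set, Store.get, hrow, hrow']
    · simp [Store.set, hrow, hrow', rowImage]
    · simp [Store.get, hrow]; omega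
  · rw [take_ofFn_succ, take_ofFn_succ]
    simp [Store.set, Store.get]

theorem iter_emitLetter_row {α : Type} (l : List α) (E : α → Letter → List Letter) {n : ℕ}
    (adj : Fin n → Fin n → Bool) (i : Fin n) (s : Store) (hrow : s.row = []) (hrow' : s.row' = []) :
    Iter .graph' (emitLetter l E) (markedRow adj i) ⟨none, false, false⟩ s ⟨none, false, false⟩
      { s with
        graph := (markedRow adj i).reverse ++ s.graph
        word := (blockRow l E (cell adj i)).reverse ++ s.word }
      (2 * n + 2 + l.length * (2 * n + 2)) := by
  have hcell : ∀ j, isCur .newline ⟨some (cell adj i j), false, false⟩ = false := by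
    intro j
    unfold cell
    split_ifs <;> rfl
  have h1 := Iter.ofFn_letter (k := .graph') (p := emitLetter l E) (c := 0)
    (w := cell adj i) (fun _ => ⟨none, false, false⟩)
    (fun j => { s with
      graph := ((List.ofFn (cell adj i)).take j).reverse ++ s.graph
      row := ((List.ofFn (cell adj i)).take j).reverse })
    fun j v => ⟨_, .of_eq (.seq (.pushCur rfl) (.ite_false (hcell j) (.pushCur rfl))) rfl ?_ le_rfl⟩
  · rw [take_ofFn_self, List.take_zero] at h1
    have hs : { s with row := [] } = s := by rw [← hrow]
    simp only [List.reverse_nil, List.nil_append, zero_add, mul_one] at h1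
    rw [hs] at h1
    refine (h1.append (Iter.single (c := l.length * (2 * n + 2) + (n + 1)) fun v => ⟨none, ?_⟩)).mono
      (by omega)
    -- In the invariant, the register still holds the newline before the first block is written, and
    -- is empty after each block.
    refine .of_eq (.seq (.pushCur rfl) (.ite_true rfl (.seq (.forList (c := 2 * n + 2)
      (R := fun m => ⟨if m = [] then some .newline else none, false, false⟩)
      (S := fun m => { s with
        graph := .newline :: ((List.ofFn (cell adj i)).reverse ++ s.graph)
        graph' := v
        row := (List.ofFn (cell adj i)).reverse
        word := ((m.map fun b => rowImage (E b) (cell adj i)).flatten).reverse ++ s.word }) l ?_)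
      (.seq (.push _ _) .clear)))) rfl ?_ ?_
    · intro l₁ b l₂ _
      refine Runs.of_eq (runs_emitRow (E b) adj i _ _ ?_ ?_) ?_ ?_ le_rfl
      · rfl
      · exact hrow'
      · simp
      · simp
    · simp [Store.set, Store.get, blockRow, markedRow, hrow]
    · simp [Store.set, Store.get]
  · rw [take_ofFn_succ]
    simp [Store.set, Store.get]

theorem runs_emit_block {α : Type} (l : List α) (E : α → Letter → List Letter) {n : ℕ}
    (adj : Fin n → Fin n → Bool) (r : Reg) (s : Store)
    (hr : r.flag = false ∧ r.aux = false)
    (hgraph : s.graph = (markedWord adj).reverse)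
    (hgraph' : s.graph' = []) (hrow : s.row = []) (hrow' : s.row' = []) :
    Runs (move .graph .graph' ;; forPop .graph' (emitLetter l E)) r s ⟨none, false, false⟩
      { s with
        word := ((List.ofFn fun i => blockRow l E (cell adj i)).flatten).reverse ++ s.word }
      (n * (n + 1) + 1 + (n * (2 * n + 2 + l.length * (2 * n + 2)) + 1)) := by
  have h := Iter.ofFn (k := .graph') (p := emitLetter l E) (w := markedRow adj)
    (c := 2 * n + 2 + l.length * (2 * n + 2)) (fun _ => ⟨none, false, false⟩)
    (fun i => { s with
      graph := ((List.ofFn (markedRow adj)).take i).flatten.reverse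
      word := ((List.ofFn fun i => blockRow l E (cell adj i)).take i).flatten.reverse ++ s.word })
    fun i => ?_
  · rw [take_ofFn_self, take_ofFn_self] at h
    refine .of_eq (.seq_of_eq (.move (by decide)) (h.finish.forPop_cur (x := none)) ?_ ?_) rfl ?_ ?_
    · simp [hr]
    · simp [Store.set, Store.get, hgraph, hgraph', markedWord]
    · simp [Store.set, hgraph, hgraph', markedWord]
    · simp [Store.get, hgraph, length_markedWord]
  · have := iter_emitLetter_row l E adj i { s with
      graph := ((List.ofFn (markedRow adj)).take i).flatten.reverse
      word := ((List.ofFn fun i => blockRow l E (cell adj i)).take i).flatten.reverse ++ s.word }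
      hrow hrow'
    rw [take_ofFn_succ, take_ofFn_succ]
    simpa using this

theorem runs_emit {α : Type} (l : List α) (E : α → α → Letter → List Letter) {n : ℕ}
    (adj : Fin n → Fin n → Bool) :
    Runs (emit l E) ⟨none, false, false⟩
      { Store.empty with graph := (markedWord adj).reverse, count := unary n }
      ⟨none, false, false⟩
      { Store.empty with
        graph := (markedWord adj).reverse, count := unary n
        word := (blockMatrix l E (cell adj)).reverse }
      (l.length * (n * (n + 1) + 1 + (n * (2 * n + 2 + l.length * (2 * n + 2)) + 1))) := by
  refine (Runs.forList (R := fun _ => ⟨none, false, false⟩) (S := fun m => { Store.empty with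
        graph := (markedWord adj).reverse, count := unary n
        word := ((m.map fun a =>
          (List.ofFn fun i => blockRow l (E a) (cell adj i)).flatten).flatten).reverse }) l
    fun l₁ a l₂ _ => ?_).of_eq rfl rfl le_rfl
  refine (runs_emit_block l (E a) adj _ _ ⟨rfl, rfl⟩ rfl rfl rfl rfl).of_eq rfl ?_ le_rfl
  simp

/-! ### Rounding a rational matrix to bits -/

/-- A test that is passed by the rational numbers `q ≥ 2⁻ᵉ`, and failed by those with
`2 q ≤ 2⁻ᵉ`. -/
def isLarge (e : ℕ) (q : ℚ) : Bool := decide (0 < q ∧ q.den.size ≤ q.num.natAbs.size + e)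

/-- A word of bits. -/
def bitWord {n : ℕ} (p : Fin n → Bool) : List Letter := List.ofFn fun j => .bit (p j)

namespace Prog

/-- Read a letter of a matrix of rational numbers, and write the result of `isLarge` at the end of
each number. The stack `row` holds the length of the numerator, `flag` says that the test has
failed, and `aux` says that the denominator is being read. -/
def roundLetter (e : ℕ) : Prog :=
  .ite (isCur .newline) skip
  (.ite (isCur .comma)
    (.push .word (fun r => .bit !r.flag) ;; clear .row ;; .load fun _ => ⟨none, false, false⟩)
  (.ite (isCur .minus) (.load fun r => { r with flag := true })
  (.ite (isCur .slash)
    (.pop .row ;;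
      .ite (fun r => r.cur.isNone) (.load fun r => { r with flag := true }) (pushCur .row) ;;
      pushWord .row (unary e) ;; .load fun r => { r with aux := true })
  (.ite (fun r => r.aux)
    (.pop .row ;; .ite (fun r => r.cur.isNone) (.load fun r => { r with flag := true }) skip)
    (pushCur .row)))))

/-- Round a matrix of rational numbers. -/
def round (e : ℕ) : Prog := forPop .word' (roundLetter e)

end Prog

theorem iter_roundLetter_num (e : ℕ) (f : Bool) (u : List Bool) (s : Store) :
    Iter .word' (roundLetter e) (u.map .bit) ⟨none, f, false⟩ s ⟨none, f, false⟩
      { s with row := (u.map .bit).reverse ++ s.row } u.length := by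
  induction u generalizing s with
  | nil => exact Iter.nil
  | cons b u ih =>
    refine ((ih { s with row := .bit b :: s.row }).cons (c := 0) fun v => ⟨_, .ite_false rfl
      (.ite_false rfl (.ite_false rfl (.ite_false rfl (.ite_false rfl (.pushCur rfl)))))⟩).of_eq
      rfl ?_ ?_
    · simp
    · simp [add_comm]

/-- Each bit of the denominator uses up one letter of `row`. The flag is raised exactly if the
letters run out, which compares the two lengths. -/
theorem iter_roundLetter_den (e : ℕ) (f : Bool) (u : List Bool) (s : Store) :
    Iter .word' (roundLetter e) (u.map .bit) ⟨none, f, true⟩ s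
      ⟨none, f || decide (s.row.length < u.length), true⟩
      { s with row := s.row.drop u.length } u.length := by
  induction u generalizing s f with
  | nil => simpa using Iter.nil
  | cons b u ih =>
    cases hrow : s.row with
    | nil =>
      refine ((ih true s).cons (c := 0) fun v => ⟨none, .ite_false rfl (.ite_false rfl
        (.ite_false rfl (.ite_false rfl (.ite_true rfl (.of_eq (.seq (.pop _)
          (.ite_true ?_ (.load _))) ?_ ?_ le_rfl)))))⟩).of_eq ?_ ?_ ?_
      all_goals simp [Store.get, Store.set, hrow, add_comm]
    | cons a x =>
      refine ((ih f { s with row := x }).cons (c := 0) fun v => ⟨some a, .ite_false rfl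
        (.ite_false rfl (.ite_false rfl (.ite_false rfl (.ite_true rfl (.of_eq (.seq (.pop _)
          (.ite_false ?_ .skip)) ?_ ?_ le_rfl)))))⟩).of_eq ?_ ?_ ?_
      all_goals simp [Store.get, Store.set, hrow, add_comm]

/-- An empty `row` at the slash means numerator zero, as zero has no bits. The additional `e`
letters account for the factor `2 ^ e` in the comparison. -/
theorem iter_roundLetter_slash (e : ℕ) (f : Bool) (s : Store) :
    Iter .word' (roundLetter e) [.slash] ⟨none, f, false⟩ s ⟨none, f || s.row.isEmpty, true⟩
      { s with row := unary e ++ s.row } 1 := by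
  cases hrow : s.row with
  | nil =>
    refine Iter.single (c := 0) fun v => ⟨none, .ite_false rfl (.ite_false rfl
      (.ite_false rfl (.ite_true rfl (.of_eq (.seq (.pop _) (.seq (.ite_true ?_ (.load _))
      (.seq (.pushWord _) (.load _)))) ?_ ?_ le_rfl))))⟩
    all_goals simp [Store.get, Store.set, hrow]
  | cons a x =>
    refine Iter.single (c := 0) fun v => ⟨some a, .ite_false rfl (.ite_false rfl
      (.ite_false rfl (.ite_true rfl (.of_eq (.seq (.pop _) (.seq (.ite_false ?_
      (.pushCur (a := a) ?_)) (.seq (.pushWord _) (.load _)))) ?_ ?_ le_rfl))))⟩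
    all_goals simp [Store.get, Store.set, hrow]

theorem iter_roundLetter_comma (e : ℕ) (f : Bool) (s : Store) :
    Iter .word' (roundLetter e) [.comma] ⟨none, f, true⟩ s ⟨none, false, false⟩
      { s with word := .bit (!f) :: s.word, row := [] } (s.row.length + 1 + 1) := by
  refine Iter.single fun v => ⟨_, .ite_false rfl (.ite_true rfl (.of_eq (.seq (.push _ _)
    (.seq .clear (.load _))) rfl rfl (by simp [Store.get, Store.set])))⟩

/-- This is the test in the form in which the flag accumulates it: sign, vanishing numerator,
denominator too long. -/
theorem isLarge_eq (e : ℕ) (q : ℚ) :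
    isLarge e q = !(decide (q < 0) || q.num.natAbs.bits.isEmpty ||
      decide (q.num.natAbs.bits.length + e < q.den.bits.length)) := by
  have h0 : q.num.natAbs.bits.isEmpty = decide (q = 0) := by
    rw [Bool.eq_iff_iff]
    simp only [List.isEmpty_iff, decide_eq_true_eq]
    rw [← List.length_eq_zero_iff, Nat.size_eq_bits_len, Nat.size_eq_zero]
    simp
  rw [h0, isLarge, Bool.eq_iff_iff]
  simp only [Nat.size_eq_bits_len, decide_eq_true_eq, Bool.not_eq_true', Bool.or_eq_false_iff,
    decide_eq_false_iff_not, not_lt, and_congr_left_iff]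
  intro _
  rw [lt_iff_le_and_ne, ne_comm]

theorem iter_roundLetter (e : ℕ) (q : ℚ) (s : Store) (hrow : s.row = []) :
    Iter .word' (roundLetter e) (encodeRational q ++ [.comma]) ⟨none, false, false⟩ s
      ⟨none, false, false⟩ { s with word := .bit (isLarge e q) :: s.word }
      (2 * (encodeRational q ++ [Letter.comma]).length + e + 2) := by
  have h1 : Iter .word' (roundLetter e) (if q < 0 then [Letter.minus] else []) ⟨none, false, false⟩
      s ⟨none, decide (q < 0), false⟩ s (if q < 0 then [Letter.minus] else []).length := by
    split_ifs with h
    · simp only [h, decide_true]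
      exact Iter.single (c := 0) fun v => ⟨_, .ite_false rfl (.ite_false rfl
        (.ite_true rfl (.load _)))⟩
    · simpa [h] using Iter.nil
  have h2 := (((h1.append (iter_roundLetter_num e _ q.num.natAbs.bits s)).append
    (iter_roundLetter_slash e _ _)).append (iter_roundLetter_den e _ q.den.bits _)).append
    (iter_roundLetter_comma e _ _)
  have hlen : (encodeRational q ++ [Letter.comma]).length =
      (if q < 0 then [Letter.minus] else []).length + q.num.natAbs.bits.length + 1 +
        q.den.bits.length + 1 := by
    simp [encodeRational, encodeNatural]; omega
  rw [hlen]
  unfold encodeRational encodeNatural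
  refine h2.of_eq rfl ?_ ?_
  · rw [isLarge_eq]
    simp [hrow, add_comm, Bool.or_assoc]
  · simp [hrow]; omega

/-- Separators are dropped, so the result is one stream of bits, which can be cut into chunks of a
different length later. -/
theorem runs_round (e : ℕ) {N ℓ : ℕ} (B : Matrix (Fin N) (Fin N) ℚ)
    (hℓ : ∀ i j, (encodeRational (B i j) ++ [Letter.comma]).length ≤ ℓ) (s : Store) (hrow : s.row = [])
    (hword' : s.word' = encodeMatrix encodeRational B) (hword : s.word = []) :
    Runs (round e) ⟨none, false, false⟩ s ⟨none, false, false⟩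
      { s with
        word := ((List.ofFn fun i => bitWord fun j => isLarge e (B i j)).flatten).reverse
        word' := [] }
      (N * (N * (2 * ℓ + e + 2) + 1) + 1) := by
  have h := Iter.ofFn (k := .word') (p := roundLetter e) (c := N * (2 * ℓ + e + 2) + 1)
    (w := fun i => (List.ofFn fun j => encodeRational (B i j) ++ [.comma]).flatten ++ [.newline])
    (fun _ => ⟨none, false, false⟩)
    (fun i => { s with
      word := ((List.ofFn fun i => bitWord fun j => isLarge e (B i j)).take i).flatten.reverse })
    fun i => ?_
  · rw [take_ofFn_self] at h
    refine (h.finish.of_eq_left rfl ?_).of_eq rfl rfl le_rfl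
    simp only [Store.set]
    rw [← encodeMatrix, ← hword', List.take_zero, List.flatten_nil, List.reverse_nil, ← hword]
  · have h1 := Iter.ofFn (k := .word') (p := roundLetter e) (c := 2 * ℓ + e + 2)
      (w := fun j => encodeRational (B i j) ++ [.comma])
      (fun _ => ⟨none, false, false⟩)
      (fun j => { s with
        word := ((bitWord fun j => isLarge e (B i j)).take j).reverse ++
          ((List.ofFn fun i => bitWord fun j => isLarge e (B i j)).take i).flatten.reverse })
      fun j => ?_
    · refine h1.append (Iter.single (c := 0) fun v => ⟨_, .of_eq (.ite_true rfl .skip) rfl ?_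
        le_rfl⟩)
      rw [take_ofFn_succ, bitWord, take_ofFn_self]
      simp [bitWord]
    · rw [bitWord, take_ofFn_succ]
      refine (iter_roundLetter e (B i j) _ ?_).of_eq rfl ?_ ?_
      · exact hrow
      · simp
      · have := hℓ i j
        omega

/-! ### Extracting an independent set -/

/-- The vertices of `p` that have no neighbour in `p`. -/
def isolated {n : ℕ} (adj : Fin n → Fin n → Bool) (p : Fin n → Bool) (i : Fin n) : Bool :=
  p i && !(List.ofFn fun j => decide (cell adj i j = .bit true) && p j).any id

/-- The number of bits that are set. -/
def ones (w : List Letter) : ℕ := w.count (.bit true)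

namespace Prog

/-- Read a letter of the marked adjacency matrix, and write at the end of each row whether its vertex
is isolated in the set with indicator vector `row`. -/
def selectLetter : Prog :=
  pushCur .graph ;; .ite (isCur .newline)
    (.pop .diag ;; .push .sel (fun r => .bit (isCur (.bit true) r && !r.flag)) ;;
      .load (fun r => { r with flag := false }) ;; move .row' .row)
    (.ite (isCur (.bit true))
      (.pop .row ;; pushCur .row' ;;
        .load fun r => { r with flag := r.flag || isCur (.bit true) r })
      (.pop .row ;; pushCur .row'))

/-- Remove `R` letters from the stack `count` for each bit that is set. -/
def tallyLetter (R : ℕ) : Prog :=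
  pushCur .sel' ;; .ite (isCur (.bit true))
    (forList (List.replicate R ()) fun _ =>
      .pop .count ;; .ite (fun r => r.cur.isSome) (pushCur .count') skip)
    skip

/-- Read the next `n` bits. -/
def readChunk : Prog :=
  forPop .count (pushCur .count' ;; .pop .word' ;; pushCur .row' ;; pushCur .diag') ;;
    move .count' .count ;; move .diag' .diag ;; move .row' .row

/-- Write the indicator vector of the isolated vertices to `out`, if there are at least `n / R`. -/
def keepIfLarge (R : ℕ) : Prog :=
  forPop .sel (tallyLetter R) ;; .pop .count ;;
    .ite (fun r => r.cur.isNone) (clear .out ;; move .sel' .sel ;; move .sel .out)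
      (pushCur .count ;; clear .sel') ;;
    move .count' .count

/-- Handle `n` bits. -/
def processChunk (R : ℕ) : Prog :=
  pushCur .word' ;; readChunk ;; move .graph .graph' ;; forPop .graph' selectLetter ;;
    clear .row ;; keepIfLarge R

end Prog

@[simp] theorem length_bitWord {n : ℕ} (p : Fin n → Bool) : (bitWord p).length = n := by
  simp [bitWord]

theorem take_bitWord_succ {n : ℕ} (p : Fin n → Bool) (j : Fin n) :
    (bitWord p).take (j + 1) = (bitWord p).take j ++ [.bit (p j)] :=
  take_ofFn_succ _ j

theorem drop_bitWord {n : ℕ} (p : Fin n → Bool) (j : Fin n) :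
    (bitWord p).drop j = .bit (p j) :: (bitWord p).drop (j + 1) := by
  rw [List.drop_eq_getElem_cons (by simp)]
  simp [bitWord]

theorem unary_eq_ofFn (n : ℕ) : unary n = List.ofFn fun _ : Fin n => Letter.comma := by
  simp [unary, List.ofFn_const]

/-- Two copies are needed: `row` is scanned along each row of the adjacency matrix, whereas `diag`
yields one bit per row, the membership of the vertex of that row. -/
theorem runs_readChunk {n : ℕ} (p : Fin n → Bool) (w : List Letter) (r : Reg) (s : Store)
    (hcount : s.count = unary n) (hword' : s.word' = bitWord p ++ w) (hcount' : s.count' = [])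
    (hrow : s.row = []) (hrow' : s.row' = []) (hdiag : s.diag = []) (hdiag' : s.diag' = []) :
    Runs readChunk r s { r with cur := none }
      { s with word' := w, row := bitWord p, diag := bitWord p } (4 * n + 4) := by
  have h := Iter.ofFn_letter (k := .count)
    (p := pushCur .count' ;; .pop .word' ;; pushCur .row' ;; pushCur .diag') (c := 0)
    (w := fun _ : Fin n => Letter.comma) (fun _ => r)
    (fun j => { s with
      count' := unary j
      word' := (bitWord p).drop j ++ w
      row' := ((bitWord p).take j).reverse
      diag' := ((bitWord p).take j).reverse })
    fun j v => ⟨some (.bit (p j)), ?_⟩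
  · rw [← unary_eq_ofFn] at h
    refine (Runs.seq (h.finish.of_eq_left rfl ?_) (.seq (.move (by decide)) (.seq
      (.move (by decide)) (.move (by decide))))).of_eq rfl ?_ ?_
    · simp only [Store.set, ← hcount, List.drop_zero, ← hword', List.take_zero, List.reverse_nil,
        unary_zero]
      cases s
      simp_all
    · simp [Store.set, Store.get, hcount, hcount', hrow, hrow', hdiag, hdiag']
    · simp [Store.set, Store.get]; omega
  · rw [take_bitWord_succ, drop_bitWord]
    refine .of_eq (.seq (.pushCur rfl) (.seq (.pop _) (.seq (.pushCur (a := .bit (p j)) ?_)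
      (.pushCur (a := .bit (p j)) ?_)))) ?_ ?_ le_rfl
    all_goals simp [Store.set, Store.get, unary_succ]

/-- The flag accumulates whether a neighbour in the set has been seen. The mark on the diagonal
keeps a vertex from counting as its own neighbour. -/
theorem iter_selectLetter_row {n : ℕ} (adj : Fin n → Fin n → Bool) (p : Fin n → Bool) (i : Fin n)
    (s : Store) (hrow : s.row = bitWord p) (hrow' : s.row' = []) {d : List Letter}
    (hdiag : s.diag = .bit (p i) :: d) :
    Iter .graph' selectLetter (markedRow adj i) ⟨none, false, false⟩ s ⟨none, false, false⟩
      { s with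
        graph := (markedRow adj i).reverse ++ s.graph
        diag := d
        sel := .bit (isolated adj p i) :: s.sel } (2 * n + 2) := by
  have h := Iter.ofFn_letter (k := .graph') (p := selectLetter) (c := 0) (w := cell adj i)
    (fun j => ⟨none, ((List.ofFn fun j => decide (cell adj i j = .bit true) && p j).take j).any id,
      false⟩)
    (fun j => { s with
      graph := ((List.ofFn (cell adj i)).take j).reverse ++ s.graph
      row := (bitWord p).drop j
      row' := ((bitWord p).take j).reverse })
    fun j v => ⟨some (.bit (p j)), ?_⟩
  · rw [take_ofFn_self, take_ofFn_self] at h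
    simp only [List.take_zero, List.reverse_nil, List.nil_append, List.drop_zero,
      List.any_nil] at h
    have hs : { s with row := bitWord p, row' := [] } = s := by cases s; simp_all
    rw [hs] at h
    refine (h.append (Iter.single (c := n + 1) fun v => ⟨none, ?_⟩)).mono (by omega)
    refine .of_eq (.seq (.pushCur rfl) (.ite_true rfl (.seq (.pop _) (.seq (.push _ _)
      (.seq (.load _) (.move (by decide))))))) ?_ ?_ ?_
    · rfl
    · cases hp : p i <;> simp [Store.set, Store.get, hrow, hrow', hdiag, markedRow, isolated, isCur, hp]
    · simp [Store.set, Store.get]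
  · rw [take_bitWord_succ, take_ofFn_succ, take_ofFn_succ, drop_bitWord]
    have hn : ∀ f, isCur .newline ⟨some (cell adj i j), f, false⟩ = false := by
      intro f
      unfold cell
      split_ifs <;> rfl
    by_cases hc : cell adj i j = .bit true
    · refine .of_eq (.seq (.pushCur rfl) (.ite_false (hn _) (.ite_true (by simp [isCur, hc])
        (.seq (.pop _) (.seq (.pushCur (a := .bit (p j)) ?_) (.load _)))))) ?_ ?_ le_rfl
      all_goals simp [Store.set, Store.get, hc, isCur]
    · refine .of_eq (.seq (.pushCur rfl) (.ite_false (hn _) (.ite_false (by simp [isCur, hc])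
        (.seq (.pop _) (.pushCur (a := .bit (p j)) ?_))))) ?_ ?_ le_rfl
      all_goals simp [Store.set, Store.get, hc]

theorem runs_select {n : ℕ} (adj : Fin n → Fin n → Bool) (p : Fin n → Bool)
    (x : Option Letter) (s : Store) (hgraph : s.graph = [])
    (hgraph' : s.graph' = markedWord adj) (hrow : s.row = bitWord p) (hrow' : s.row' = [])
    (hdiag : s.diag = bitWord p) (hsel : s.sel = []) :
    Runs (forPop .graph' selectLetter) ⟨x, false, false⟩ s ⟨none, false, false⟩
      { s with
        graph := (markedWord adj).reverse
        graph' := []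
        diag := []
        sel := (bitWord (isolated adj p)).reverse } (n * (2 * n + 2) + 1) := by
  have h := Iter.ofFn (k := .graph') (p := selectLetter) (w := markedRow adj) (c := 2 * n + 2)
    (fun _ => ⟨none, false, false⟩)
    (fun i => { s with
      graph := ((List.ofFn (markedRow adj)).take i).flatten.reverse
      diag := (bitWord p).drop i
      sel := ((bitWord (isolated adj p)).take i).reverse })
    fun i => ?_
  · refine ((h.finish.forPop_cur (x := x)).of_eq_left rfl ?_).of_eq rfl ?_ le_rfl
    · rw [← markedWord]
      cases s
      simp_all [Store.set]
    · simp [Store.set, take_ofFn_self, markedWord]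
  · rw [take_bitWord_succ, take_ofFn_succ]
    refine Iter.of_eq (iter_selectLetter_row adj p i _ ?_ ?_ (d := (bitWord p).drop (i + 1)) ?_)
      rfl ?_ le_rfl
    · exact hrow
    · exact hrow'
    · exact drop_bitWord p i
    · simp

/-- The comparison of `n` with `R * ones u` is a truncated subtraction in unary. The letters taken
away are kept in `count'`, so that `n` can be restored. -/
theorem iter_tallyLetter (R n : ℕ) (u : List Letter) (x : ℕ) (s : Store)
    (hcount : s.count = unary (n - x)) (hcount' : s.count' = unary (min n x)) :
    Iter .sel (tallyLetter R) u ⟨none, false, false⟩ s ⟨none, false, false⟩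
      { s with
        count := unary (n - (x + R * ones u))
        count' := unary (min n (x + R * ones u))
        sel' := u.reverse ++ s.sel' } u.length := by
  induction u generalizing s x with
  | nil =>
    refine Iter.nil.of_eq rfl ?_ le_rfl
    simp [ones, ← hcount, ← hcount']
  | cons a u ih =>
    by_cases ha : a = .bit true
    · subst ha
      refine ((ih (x + R) { s with
        count := unary (n - (x + R)), count' := unary (min n (x + R))
        sel' := .bit true :: s.sel' } rfl rfl).cons (c := 0) fun v => ?_).of_eq rfl ?_ ?_
      · have key : ∀ (m : ℕ) (y : ℕ) (r : Reg) (s : Store) (hcount : s.count = unary (n - y))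
          (hcount' : s.count' = unary (min n y)),
          ∃ z, Runs (forList (List.replicate m ()) fun _ => .pop .count ;;
            .ite (fun r => r.cur.isSome) (pushCur .count') skip) r s { r with cur := z }
            { s with count := unary (n - (y + m)), count' := unary (min n (y + m)) } 0 := by
          intro m
          induction m with
          | zero =>
            intro y r s h1 h2
            refine ⟨r.cur, Runs.skip.of_eq rfl ?_ le_rfl⟩
            simp [← h1, ← h2]
          | succ m ihm =>
            intro y r s h1 h2
            by_cases hy : y < n
            · obtain ⟨z, hz⟩ := ihm (y + 1) { r with cur := some .comma }
                { s with count := unary (n - (y + 1)), count' := unary (min n (y + 1)) } rfl rfl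
              obtain ⟨q, hq⟩ : ∃ q, n - y = q + 1 := ⟨n - y - 1, by omega⟩
              refine ⟨z, (Runs.seq_of_eq (.seq (.pop _) (.ite_true ?_ (.pushCur (a := .comma) ?_)))
                hz ?_ ?_).of_eq rfl ?_ le_rfl⟩
              · simp [Store.get, h1, hq, unary_succ]
              · simp [Store.get, h1, hq, unary_succ]
              · simp [Store.get, h1, hq, unary_succ]
              · simp [Store.get, Store.set, h1, h2, hq, unary_succ]
                rw [show n - (y + 1) = q by omega, show min n (y + 1) = min n y + 1 by omega]
                exact ⟨rfl, rfl⟩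
              · simp [add_assoc, add_comm 1 m]
            · obtain ⟨z, hz⟩ := ihm y { r with cur := none } s h1 h2
              have h0 : n - y = 0 := by omega
              refine ⟨z, (Runs.seq_of_eq (.seq (.pop _) (.ite_false ?_ .skip)) hz ?_ ?_).of_eq
                rfl ?_ le_rfl⟩
              · simp [Store.get, h1, h0]
              · simp [Store.get, h1, h0]
              · simp [Store.get, Store.set, h1, h0]
                cases s
                simp_all
              · rw [show n - (y + (m + 1)) = n - (y + m) by omega,
                  show min n (y + (m + 1)) = min n (y + m) by omega]
        obtain ⟨z, hz⟩ := key R x ⟨some (.bit true), false, false⟩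
          { s with sel := v, sel' := .bit true :: s.sel' } hcount hcount'
        exact ⟨z, .of_eq (.seq (.pushCur rfl) (.ite_true rfl hz)) rfl rfl le_rfl⟩
      · have : x + R + R * ones u = x + R * ones (.bit true :: u) := by
          simp [ones]; ring
        simp [this]
      · simp [add_comm]
    · have h1 : ones (a :: u) = ones u := List.count_cons_of_ne (by simpa using ha)
      refine ((ih x { s with sel' := a :: s.sel' } hcount hcount').cons (c := 0) fun v =>
        ⟨some a, .seq (.pushCur rfl) (.ite_false (by simp [isCur, ha]) .skip)⟩).of_eq rfl ?_ ?_
      · simp [h1]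
      · simp [add_comm]

/-- After the tally, `count` is empty exactly if `n ≤ R * ones u`. The bound on the old output only
serves to bound the cost of clearing it. -/
theorem runs_keepIfLarge (R n : ℕ) (u : List Letter) (hu : u.length = n) (s : Store)
    (hcount : s.count = unary n) (hcount' : s.count' = []) (hsel : s.sel = u.reverse)
    (hsel' : s.sel' = []) (hout : s.out.length ≤ n) :
    Runs (keepIfLarge R) ⟨none, false, false⟩ s ⟨none, false, false⟩
      { s with sel := [], out := if n ≤ R * ones u then u else s.out } (5 * n + 6) := by
  have h := (iter_tallyLetter R n u.reverse 0 s (by simpa using hcount)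
    (by simpa using hcount')).finish
  have hones : ones u.reverse = ones u := List.count_reverse
  rw [hones, List.length_reverse, hu, zero_add, List.reverse_reverse, hsel', List.append_nil] at h
  have hs : s.set .sel u.reverse = s := by rw [← hsel]; exact Store.set_get s .sel
  rw [hs] at h
  split_ifs with hn
  · refine (Runs.seq h (.seq (.pop _) (.seq (.ite_true ?_ (.seq .clear (.seq (.move (by decide))
      (.move (by decide))))) (.move (by decide))))).of_eq rfl ?_ ?_
    · simp [Store.get, Store.set, hn]
    · simp [Store.get, Store.set, hn, hcount, hcount', hsel']
    · simp [Store.get, Store.set, hn, hu]; omega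
  · obtain ⟨q, hq⟩ : ∃ q, n - R * ones u = q + 1 := ⟨n - R * ones u - 1, by omega⟩
    refine (Runs.seq h (.seq (.pop _) (.seq (.ite_false ?_ (.seq (.pushCur (a := .comma) ?_)
      .clear)) (.move (by decide))))).of_eq rfl ?_ ?_
    · simp [Store.get, Store.set, hq, unary_succ]
    · simp [Store.get, Store.set, hq, unary_succ]
    · have hc : unary (min n (R * ones u)) ++ Letter.comma :: unary q = unary n := by
        rw [← unary_succ, unary, unary, List.replicate_append_replicate, unary]
        congr 1
        omega
      simp [Store.get, Store.set, hq, hcount, hcount', hsel', unary_succ, hc]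
    · simp [Store.get, Store.set, hq, hu]; omega

/-- The enclosing loop has already popped the first letter `a` of the chunk, so it is pushed back
before the chunk is read. -/
theorem runs_processChunk (R : ℕ) {n : ℕ} (adj : Fin n → Fin n → Bool) (p : Fin n → Bool)
    (w o : List Letter) (a : Letter) (v : List Letter) (hav : bitWord p ++ w = a :: v)
    (ho : o.length ≤ n) :
    Runs (processChunk R) ⟨some a, false, false⟩
      { Store.empty with
        graph := (markedWord adj).reverse, count := unary n, word' := v, out := o }
      ⟨none, false, false⟩
      { Store.empty with
        graph := (markedWord adj).reverse, count := unary n, word' := w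
        out := if n ≤ R * ones (bitWord (isolated adj p)) then bitWord (isolated adj p) else o }
      (3 * n * n + 20 * n + 20) := by
  refine Runs.of_eq (.seq (.pushCur rfl) (.seq (runs_readChunk p w _ _ ?_ ?_ ?_ ?_ ?_ ?_ ?_)
    (.seq (.move (by decide)) (.seq (runs_select adj p _ _ ?_ ?_ ?_ ?_ ?_ ?_) (.seq .clear
    (runs_keepIfLarge R n (bitWord (isolated adj p)) ?_ _ ?_ ?_ ?_ ?_ ?_)))))) ?_ ?_ ?_
  all_goals simp [Store.set, Store.get, Store.empty, length_markedWord, ho, hav]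
  nlinarith

/-- The result of processing chunks of bits one after the other. -/
def lastLarge (R : ℕ) {n : ℕ} (adj : Fin n → Fin n → Bool) (o : List Letter)
    (c : List (Fin n → Bool)) : List Letter :=
  c.foldl (fun o p =>
    if n ≤ R * ones (bitWord (isolated adj p)) then bitWord (isolated adj p) else o) o

theorem runs_processChunks (R : ℕ) {n : ℕ} (hn : 0 < n) (adj : Fin n → Fin n → Bool)
    (c : List (Fin n → Bool)) (o : List Letter) (ho : o.length ≤ n) :
    Runs (forPop .word' (processChunk R)) ⟨none, false, false⟩
      { Store.empty with
        graph := (markedWord adj).reverse, count := unary n, word' := (c.map bitWord).flatten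
        out := o }
      ⟨none, false, false⟩
      { Store.empty with
        graph := (markedWord adj).reverse, count := unary n, out := lastLarge R adj o c }
      (c.length * (3 * n * n + 20 * n + 21) + 1) := by
  induction c generalizing o with
  | nil => exact (Runs.forPop_nil rfl).of_eq rfl rfl (by simp)
  | cons p c ih =>
    obtain ⟨a, v, hav⟩ : ∃ a v, bitWord p ++ (c.map bitWord).flatten = a :: v := by
      cases h : bitWord p ++ (c.map bitWord).flatten with
      | nil =>
        have := congrArg List.length h
        simp at this
        omega
      | cons a v => exact ⟨a, v, rfl⟩
    refine (Runs.forPop_cons (a := a) (v := v) (by simpa [Store.get] using hav)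
      (runs_processChunk R adj p (c.map bitWord).flatten o a v hav ho) (ih _ ?_)).mono ?_
    · dsimp only
      split_ifs
      · simp
      · exact ho
    · simp only [List.length_cons]
      ring_nf
      omega

/-- If some chunk yields a large set, then so does the final output. -/
theorem lastLarge_spec (R : ℕ) {n : ℕ} (adj : Fin n → Fin n → Bool) (o : List Letter)
    (c : List (Fin n → Bool)) (h : ∃ p ∈ c, n ≤ R * ones (bitWord (isolated adj p))) :
    ∃ p, n ≤ R * ones (bitWord (isolated adj p)) ∧ lastLarge R adj o c = bitWord (isolated adj p) := by
  -- The last successful chunk determines the output, so the induction runs from the end of the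
  -- list.
  induction c using List.reverseRecOn with
  | nil => simp at h
  | append_singleton c q ih =>
    rw [lastLarge, List.foldl_append, List.foldl_cons, List.foldl_nil]
    split_ifs with hq
    · exact ⟨q, hq, rfl⟩
    · refine ih ?_
      obtain ⟨p, hp, hp'⟩ := h
      rcases List.mem_append.1 hp with h | h
      · exact ⟨p, h, hp'⟩
      · rw [List.mem_singleton] at h
        subst h
        exact absurd hp' hq

/-! ### Calling the subroutine -/

namespace Prog

/-- Take the output of the subroutine letter by letter and execute `p` after each letter. -/
def forTake (p : Prog) : Prog := .take ;; .loop (fun r => r.cur.isSome) (p ;; .take)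

/-- Call the subroutine on the reverse of the stack `word`. -/
def invoke : Prog :=
  forPop .word (.give fun r => r.cur.getD .bot) ;; .call ;; forTake (pushCur .word) ;;
    move .word .word'

end Prog

section

variable {T : TM2ComputableAux Letter Letter}

/-- Moving between stacks reverses the word. As `word` is written back to front, the subroutine
receives its input in the right order. -/
theorem exec_give (u : List Letter) (r : Reg) (s : Store) (S : ∀ j, List (T.tm.Γ j)) :
    Exec T (forPop .word (.give fun r => r.cur.getD .bot)) ⟨r, { s with word := u }, S⟩
      ⟨{ r with cur := none }, { s with word := [] },
        Function.update S T.tm.k₀ (u.reverse.map T.inputAlphabet.symm ++ S T.tm.k₀)⟩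
      (u.length + 1) := by
  induction u generalizing r S with
  | nil => simpa using Exec.forPop_nil (m := ⟨r, { s with word := [] }, S⟩) rfl
  | cons a u ih =>
    have h := Exec.forPop_cons (m := ⟨r, { s with word := a :: u }, S⟩) (k := .word) rfl
      (Exec.give (fun r => r.cur.getD .bot) _)
      (ih { r with cur := some a }
        (Function.update S T.tm.k₀ (T.inputAlphabet.symm a :: S T.tm.k₀)))
    simpa [add_comm] using h

theorem exec_forTake (y : List Letter) (r : Reg) (s : Store) (S : ∀ j, List (T.tm.Γ j)) :
    Exec T (forTake (pushCur .word))
      ⟨r, s, Function.update S T.tm.k₁ (y.map T.outputAlphabet.symm)⟩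
      ⟨{ r with cur := none }, { s with word := y.reverse ++ s.word },
        Function.update S T.tm.k₁ []⟩ (y.length + 1) := by
  induction y generalizing r s with
  | nil =>
    have h := Exec.seq (Exec.take ⟨r, s, Function.update S T.tm.k₁ []⟩)
      (Exec.loop_exit (p := pushCur .word ;; .take) (b := fun r => r.cur.isSome) (by simp))
    simpa [forTake] using h
  | cons a y ih =>
    have ih' := ih { r with cur := some a } { s with word := a :: s.word }
    generalize hn : y.length + 1 = n at ih'
    cases ih' with
    | @seq _ _ _ m' _ c d h₁ h₂ =>
      have h₀ := Exec.take (T := T)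
        ⟨r, s, Function.update S T.tm.k₁ ((a :: y).map T.outputAlphabet.symm)⟩
      simp only [List.map_cons, Function.update_self, List.head?_cons, Option.map_some,
        Equiv.apply_symm_apply, List.tail_cons, Function.update_idem] at h₀
      have h := Exec.seq h₀ (Exec.loop_step (p := pushCur .word ;; .take)
        (b := fun r => r.cur.isSome) rfl (Exec.seq (Exec.push _ _ _) h₁) h₂)
      rw [show (a :: y).length + 1 = 0 + (1 + (0 + c + d)) by simp; omega]
      simpa [forTake] using h

theorem initList_eq (w : List (T.tm.Γ T.tm.k₀)) :
    initList T.tm w = ⟨some T.tm.main, T.tm.initialState,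
      Function.update (fun _ => []) T.tm.k₀ w⟩ := by
  rw [initList]
  congr 1
  funext k
  by_cases h : k = T.tm.k₀
  · subst h; simp
  · simp [h]

theorem haltList_eq (w : List (T.tm.Γ T.tm.k₁)) :
    haltList T.tm w = ⟨none, T.tm.initialState, Function.update (fun _ => []) T.tm.k₁ w⟩ := by
  rw [haltList]
  congr 1
  funext k
  by_cases h : k = T.tm.k₁
  · subst h; simp
  · simp [h]

/-- The subroutine halts with only its output stack filled, and that stack is drained afterwards, so
all stacks of the subroutine are empty at the end. -/
theorem exec_invoke {w y : List Letter} {t : ℕ}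
    (h : TM2OutputsInTime T.tm (w.map T.inputAlphabet.symm)
      (some (y.map T.outputAlphabet.symm)) t) (s : Store) (hword : s.word = w.reverse)
    (hword' : s.word' = []) :
    ∃ n ≤ w.length + t + 2 * y.length + 3,
      Exec T invoke ⟨⟨none, false, false⟩, s, fun _ => []⟩
        ⟨⟨none, false, false⟩, { s with word := [], word' := y }, fun _ => []⟩ n := by
  obtain ⟨⟨n, hn⟩, hnt⟩ := h
  replace hnt : n ≤ t := hnt
  have h₁ := exec_give (T := T) w.reverse ⟨none, false, false⟩ s fun _ => []
  have hs : { s with word := w.reverse } = s := by rw [← hword]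
  rw [hs, List.reverse_reverse, List.append_nil] at h₁
  rw [initList_eq, Option.map_some, haltList_eq] at hn
  have h₂ := Exec.call n ⟨⟨none, false, false⟩, { s with word := [] }, _⟩ _ hn
  have h₃ := exec_forTake y ⟨none, false, false⟩ { s with word := [] } fun j : T.tm.K => []
  have hupd : Function.update (fun j : T.tm.K => ([] : List (T.tm.Γ j))) T.tm.k₁ [] = fun _ => [] :=
    Function.update_eq_self_iff.2 rfl
  rw [hupd] at h₃
  obtain ⟨m, hm, h₄⟩ := Runs.move (k := .word) (j := .word') (by decide)
    (r := ⟨none, false, false⟩) (s := { s with word := y.reverse }) T fun _ => []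
  refine ⟨_, ?_, h₁.seq (h₂.seq (h₃.seq (by simpa [Store.set, Store.get, hword'] using h₄)))⟩
  simp only [Store.get, List.length_reverse] at hm ⊢
  omega

/-- A machine step lengthens every stack by a bounded amount. -/
theorem exists_length_stepAux_le {K : Type} [DecidableEq K] {Γ : K → Type} {Λ σ : Type}
    (q : TM2.Stmt Γ Λ σ) :
    ∃ C, ∀ v S k, ((TM2.stepAux q v S).stk k).length ≤ (S k).length + C := by
  induction q with
  | push j f q ih =>
    obtain ⟨C, hC⟩ := ih
    refine ⟨C + 1, fun v S k => (hC v _ k).trans ?_⟩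
    by_cases h : k = j
    · subst h; simp; omega
    · rw [Function.update_of_ne h]; omega
  | peek j f q ih =>
    obtain ⟨C, hC⟩ := ih
    exact ⟨C, fun v S k => hC _ S k⟩
  | pop j f q ih =>
    obtain ⟨C, hC⟩ := ih
    refine ⟨C, fun v S k => (hC _ _ k).trans ?_⟩
    by_cases h : k = j
    · subst h; simp
    · rw [Function.update_of_ne h]
  | load f q ih =>
    obtain ⟨C, hC⟩ := ih
    exact ⟨C, fun v S k => hC _ S k⟩
  | branch f q₁ q₂ ih₁ ih₂ =>
    obtain ⟨C₁, h₁⟩ := ih₁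
    obtain ⟨C₂, h₂⟩ := ih₂
    refine ⟨C₁ + C₂, fun v S k => ?_⟩
    have := h₁ v S k
    have := h₂ v S k
    rw [TM2.stepAux]
    cases f v <;> simp only [cond_true, cond_false] <;> omega
  | goto f => exact ⟨0, fun v S k => le_rfl⟩
  | halt => exact ⟨0, fun v S k => le_rfl⟩

/-- The length of the output is bounded in terms of the running time. -/
theorem exists_length_output_le (T : TM2ComputableAux Letter Letter) :
    ∃ C, ∀ (w y : List Letter) (t : ℕ), Nonempty (TM2OutputsInTime T.tm
      (w.map T.inputAlphabet.symm) (some (y.map T.outputAlphabet.symm)) t) →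
      y.length ≤ w.length + t * C := by
  choose C hC using fun l => exists_length_stepAux_le (T.tm.m l)
  let := T.tm.ΛFin
  refine ⟨∑ l, C l, ?_⟩
  rintro w y t ⟨⟨⟨n, hn⟩, hnt⟩⟩
  have key : ∀ (n : ℕ) (c c' : TM2.Cfg T.tm.Γ T.tm.Λ T.tm.σ),
      (flip bind (TM2.step T.tm.m))^[n] (some c) = some c' →
      ∀ k, (c'.stk k).length ≤ (c.stk k).length + n * ∑ l, C l := by
    intro n
    induction n with
    | zero =>
      intro c c' h k
      simp only [Function.iterate_zero, id, Option.some.injEq] at h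
      simp [h]
    | succ n ih =>
      intro c c' h k
      rw [Function.iterate_succ_apply'] at h
      cases hd : (flip bind (TM2.step T.tm.m))^[n] (some c) with
      | none => rw [hd] at h; simp [flip] at h
      | some d =>
        rw [hd] at h
        have := ih c d hd k
        obtain ⟨_ | l, v, S⟩ := d
        · simp [flip] at h
        · simp only [flip, Option.bind_eq_bind, Option.bind_some, TM2.step, Option.some.injEq] at h
          rw [← h]
          have h1 := hC l v S k
          have h2 : C l ≤ ∑ l, C l := 
            Finset.single_le_sum (fun _ _ => Nat.zero_le _) (Finset.mem_univ l)
          simp only at this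
          rw [Nat.succ_mul]
          omega
  have h := key n _ _ (hn.trans rfl) T.tm.k₁
  rw [initList_eq, haltList_eq] at h
  simp only [Function.update_self, List.length_map] at h
  refine h.trans (add_le_add ?_ (Nat.mul_le_mul_right _ hnt))
  -- The output stack may be the input stack; only then does it initially hold the input.
  by_cases hk : T.tm.k₁ = T.tm.k₀
  · have : ∀ (k : T.tm.K) (v : List (T.tm.Γ T.tm.k₀)), k = T.tm.k₀ →
        (Function.update (fun _ => []) T.tm.k₀ v k : List (T.tm.Γ k)).length = v.length := by
      rintro k v rfl; simp
    rw [this _ _ hk, List.length_map]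
  · rw [Function.update_of_ne hk]; simp

end

/-! ### The reduction as a program -/

/-- Extraction of a large independent set by way of a matrix problem. The parameters are the blocks
of the matrix, the words of its entries, the precision of the rounding, and the inverse density of
the independent set. -/
def Prog.reduction {α : Type} (l : List α) (E : α → α → Letter → List Letter) (e R : ℕ) : Prog :=
  .pop .inp ;; .ite (fun r => r.cur.isNone) skip
    (pushCur .inp ;; .load (fun _ => Reg.start) ;; mark ;; emit l E ;; invoke ;; round e ;;
      move .word .word' ;; forPop .word' (processChunk R) ;; clear .graph ;; clear .count)

/-- This is the graph without vertices, for which the empty word is a correct answer and the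
subroutine is not called. -/
theorem exec_reduction_nil {T : TM2ComputableAux Letter Letter} {α : Type} (l : List α)
    (E : α → α → Letter → List Letter) (e R : ℕ) :
    Exec T (reduction l E e R) ⟨Reg.start, { Store.empty with inp := [] }, fun _ => []⟩
      ⟨Reg.start, { Store.empty with out := [] }, fun _ => []⟩ 0 :=
  Exec.seq (c := 0) (d := 0) (Exec.pop _ _) (Exec.ite_true rfl (Exec.load _ _))

/-- A bound for the number of jumps of the reduction, for a graph on `n` vertices and `L` blocks, if
the subroutine takes `t` steps, its input has length `w`, and its output has length `y`. -/
def reductionCost (L e n w t y : ℕ) : ℕ :=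
  (n * (3 * n + 2) + 1) +
  (L * (n * (n + 1) + 1 + (n * (2 * n + 2 + L * (2 * n + 2)) + 1))) +
  (w + t + 2 * y + 3) +
  (L * n * (L * n * (2 * y + e + 2) + 1) + 1) +
  (L * n * (L * n) + 1) +
  (L * n * L * (3 * n * n + 20 * n + 21) + 1) +
  (n * (n + 1) + 1) + (n + 1)

/-- The rounded matrix, cut into chunks of `n` bits. -/
def chunks (e : ℕ) {L n : ℕ} (B : Matrix (Fin (L * n)) (Fin (L * n)) ℚ) : List (Fin n → Bool) :=
  (List.ofFn fun i => List.ofFn fun b => fun j => isLarge e (B i (finProdFinEquiv (b, j)))).flatten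

theorem length_chunks (e : ℕ) {L n : ℕ} (B : Matrix (Fin (L * n)) (Fin (L * n)) ℚ) :
    (chunks e B).length = L * n * L := by
  simp [chunks, List.length_flatten, List.map_ofFn, Function.comp_def]

theorem ofFn_finProdFinEquiv {α : Type} {L n : ℕ} (f : Fin (L * n) → α) :
    List.ofFn f = (List.ofFn fun b => List.ofFn fun j => f (finProdFinEquiv (b, j))).flatten := by
  rw [List.ofFn_mul]
  congr 3
  funext b
  congr 1
  funext j
  congr 1
  ext
  simp [finProdFinEquiv]
  ring

theorem flatten_chunks (e : ℕ) {L n : ℕ} (B : Matrix (Fin (L * n)) (Fin (L * n)) ℚ) :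
    ((chunks e B).map bitWord).flatten =
      (List.ofFn fun i => bitWord fun j => isLarge e (B i j)).flatten := by
  rw [chunks, List.map_flatten, List.map_ofFn, List.flatten_flatten, List.map_ofFn]
  congr 2
  funext i
  rw [bitWord, ofFn_finProdFinEquiv]
  simp [List.map_ofFn, Function.comp_def, bitWord]

theorem length_entry_le {N : ℕ} (B : Matrix (Fin N) (Fin N) ℚ) (i j : Fin N) :
    (encodeRational (B i j) ++ [Letter.comma]).length ≤ (encodeMatrix encodeRational B).length := by
  refine List.Sublist.length_le ?_
  refine List.Sublist.trans ?_ (List.sublist_flatten_of_mem (List.mem_ofFn.2 ⟨i, rfl⟩))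
  refine List.Sublist.trans ?_ (List.sublist_append_left _ _)
  exact List.sublist_flatten_of_mem (List.mem_ofFn.2 ⟨j, rfl⟩)

theorem exec_reduction {T : TM2ComputableAux Letter Letter} {L : ℕ}
    (E : Fin L → Fin L → Letter → List Letter) (e R : ℕ) {n : ℕ} (hn : 0 < n)
    (adj : Fin n → Fin n → Bool) (B : Matrix (Fin (L * n)) (Fin (L * n)) ℚ) {t : ℕ}
    (hT : TM2OutputsInTime T.tm
      ((blockMatrix (List.finRange L) E (cell adj)).map T.inputAlphabet.symm)
      (some ((encodeMatrix encodeRational B).map T.outputAlphabet.symm)) t) :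
    ∃ c ≤ reductionCost L e n (blockMatrix (List.finRange L) E (cell adj)).length t
        (encodeMatrix encodeRational B).length,
      Exec T (reduction (List.finRange L) E e R)
        ⟨Reg.start, { Store.empty with inp := encodeMatrix (fun b : Bool => [Letter.bit b]) adj },
          fun _ => []⟩
        ⟨Reg.start, { Store.empty with out := lastLarge R adj [] (chunks e B) }, fun _ => []⟩ c := by
  -- As `n` is positive, the input is not empty; the initial test therefore takes the second branch
  -- and puts the popped letter back.
  obtain ⟨a, v, hav⟩ : ∃ a v, encodeMatrix (fun b : Bool => [Letter.bit b]) adj = a :: v := by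
    obtain ⟨n, rfl⟩ : ∃ m, n = m + 1 := ⟨n - 1, by omega⟩
    simp [encodeMatrix, List.ofFn_succ]
  obtain ⟨c₁, hc₁, h₁⟩ := runs_mark adj T fun _ => []
  obtain ⟨c₂, hc₂, h₂⟩ := runs_emit (List.finRange L) E adj T fun _ => []
  obtain ⟨c₃, hc₃, h₃⟩ := exec_invoke hT { Store.empty with
        graph := (markedWord adj).reverse, count := unary n
        word := (blockMatrix (List.finRange L) E (cell adj)).reverse } rfl rfl
  obtain ⟨c₄, hc₄, h₄⟩ := runs_round e B (length_entry_le B) { Store.empty with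
        graph := (markedWord adj).reverse, count := unary n
        word' := encodeMatrix encodeRational B } rfl rfl rfl T fun _ => []
  obtain ⟨c₅, hc₅, h₅⟩ := Runs.move (k := .word) (j := .word') (by decide)
    (r := ⟨none, false, false⟩) (s := { Store.empty with
        graph := (markedWord adj).reverse, count := unary n
        word := ((List.ofFn fun i => bitWord fun j => isLarge e (B i j)).flatten).reverse })
    T fun _ => []
  obtain ⟨c₆, hc₆, h₆⟩ := runs_processChunks R hn adj (chunks e B) [] (Nat.zero_le _) T fun _ => []
  obtain ⟨c₇, hc₇, h₇⟩ := Runs.seq (Runs.clear (k := .graph) (r := ⟨none, false, false⟩)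
    (s := { Store.empty with
        graph := (markedWord adj).reverse, count := unary n
        out := lastLarge R adj [] (chunks e B) })) (Runs.clear (k := .count)) T fun _ => []
  rw [flatten_chunks] at h₆
  simp only [Store.set, Store.get, List.reverse_reverse, Store.empty, List.append_nil] at h₅
  rw [hav] at h₁ ⊢
  refine ⟨_, ?_, Exec.seq (Exec.pop _ _) (Exec.ite_false rfl (Exec.seq (Exec.push _ _ _)
    (Exec.seq (Exec.load _ _) (h₁.seq (h₂.seq (h₃.seq (h₄.seq (h₅.seq (h₆.seq h₇)))))))))⟩
  have hlen : ((List.ofFn fun i => bitWord fun j => isLarge e (B i j)).flatten).length =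
      L * n * (L * n) := by
    simp [List.length_flatten, List.map_ofFn, Function.comp_def]
  simp only [Store.get, Store.set, List.length_reverse, hlen, length_markedWord,
    length_unary, List.length_finRange, length_chunks] at hc₂ hc₅ hc₆ hc₇
  unfold reductionCost
  omega

/-! ### Correctness and running time of the reduction -/

/-- The block matrix whose entry in the blocks `a`, `b` at the vertices `i`, `j` is determined by
`a`, `b` and the marked adjacency matrix at `i`, `j`. -/
def blowUp {L n : ℕ} (ent : Fin L → Fin L → Letter → Option ℚ) (adj : Fin n → Fin n → Bool) :
    Matrix (Fin (L * n)) (Fin (L * n)) (Option ℚ) := fun I J =>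
  ent (finProdFinEquiv.symm I).1 (finProdFinEquiv.symm J).1
    (cell adj (finProdFinEquiv.symm I).2 (finProdFinEquiv.symm J).2)

/-- `finProdFinEquiv` orders the pairs by block first, which is the order in which `emit` writes
them. -/
theorem encodeMatrix_blowUp {L n : ℕ} (ent : Fin L → Fin L → Letter → Option ℚ)
    (adj : Fin n → Fin n → Bool) :
    encodeMatrix encodeEntry (blowUp ent adj) =
      blockMatrix (List.finRange L) (fun a b x => encodeEntry (ent a b x) ++ [.comma])
        (cell adj) := by
  rw [encodeMatrix, ofFn_finProdFinEquiv, blockMatrix, List.flatten_flatten, List.map_ofFn,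
    ← List.ofFn_eq_map]
  congr 2
  funext a
  simp only [Function.comp_apply]
  congr 2
  funext i
  rw [ofFn_finProdFinEquiv, blockRow, List.flatten_flatten, List.map_ofFn, ← List.ofFn_eq_map]
  simp only [blowUp, rowImage, Equiv.symm_apply_apply, Function.comp_def]

/-- Only finitely many different entries occur, independently of `n`; the sum of their lengths
serves as a bound for each. -/
theorem exists_length_blowUp_le {L : ℕ} (ent : Fin L → Fin L → Letter → Option ℚ) :
    ∃ C, ∀ (n : ℕ) (adj : Fin n → Fin n → Bool),
      (encodeMatrix encodeEntry (blowUp ent adj)).length ≤ L * n * (L * n * C + 1) := by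
  refine ⟨∑ a, ∑ b, ∑ x, (encodeEntry (ent a b x) ++ [Letter.comma]).length, fun n adj => ?_⟩
  have key : ∀ a b x, (encodeEntry (ent a b x) ++ [Letter.comma]).length ≤
      ∑ a, ∑ b, ∑ x, (encodeEntry (ent a b x) ++ [Letter.comma]).length := fun a b x =>
    (Finset.single_le_sum (f := fun x => (encodeEntry (ent a b x) ++ [Letter.comma]).length)
      (fun _ _ => Nat.zero_le _) (Finset.mem_univ x)).trans <|
    (Finset.single_le_sum (f := fun b => ∑ x, (encodeEntry (ent a b x) ++ [Letter.comma]).length)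
      (fun _ _ => Nat.zero_le _) (Finset.mem_univ b)).trans <|
    (Finset.single_le_sum
      (f := fun a => ∑ b, ∑ x, (encodeEntry (ent a b x) ++ [Letter.comma]).length)
      (fun _ _ => Nat.zero_le _) (Finset.mem_univ a))
  have flat : ∀ {N : ℕ} (w : Fin N → List Letter) (c : ℕ), (∀ i, (w i).length ≤ c) →
      (List.ofFn w).flatten.length ≤ N * c := by
    intro N w c h
    rw [List.length_flatten, List.map_ofFn, List.sum_ofFn]
    calc _ ≤ ∑ _i : Fin N, c := Finset.sum_le_sum fun i _ => h i
      _ = N * c := by simp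
  refine flat _ _ fun I => ?_
  rw [List.length_append, List.length_singleton]
  exact Nat.add_le_add_right (flat _ _ fun J => key _ _ _) 1

theorem eval_mono (p : Polynomial ℕ) : Monotone fun x => p.eval x := by
  intro x y h
  simp only [Polynomial.eval_eq_sum_range]
  gcongr

theorem reductionCost_mono {L e n n' w w' t t' y y' : ℕ} (hn : n ≤ n') (hw : w ≤ w') (ht : t ≤ t')
    (hy : y ≤ y') : reductionCost L e n w t y ≤ reductionCost L e n' w' t' y' := by
  unfold reductionCost
  gcongr

theorem exists_polynomial_reductionCost (L e C D : ℕ) (time : Polynomial ℕ) :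
    ∃ p : Polynomial ℕ, ∀ x, p.eval x = reductionCost L e x (L * x * (L * x * C + 1))
      (time.eval (L * x * (L * x * C + 1)))
      (L * x * (L * x * C + 1) + time.eval (L * x * (L * x * C + 1)) * D) + 1 := by
  let n : Polynomial ℕ := .X
  let N : Polynomial ℕ := L * n
  let w : Polynomial ℕ := N * (N * C + 1)
  let t : Polynomial ℕ := time.comp w
  let y : Polynomial ℕ := w + t * D
  refine ⟨(n * (3 * n + 2) + 1) +
    (L * (n * (n + 1) + 1 + (n * (2 * n + 2 + L * (2 * n + 2)) + 1))) +
    (w + t + 2 * y + 3) +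
    (L * n * (L * n * (2 * y + e + 2) + 1) + 1) +
    (L * n * (L * n) + 1) +
    (L * n * L * (3 * n * n + 20 * n + 21) + 1) +
    (n * (n + 1) + 1) + (n + 1) + 1, fun x => ?_⟩
  simp [n, N, w, t, y, reductionCost]

theorem isolated_iff {n : ℕ} (adj : Fin n → Fin n → Bool) (p : Fin n → Bool) (i : Fin n) :
    isolated adj p i = true ↔ p i = true ∧ ∀ j, j ≠ i → adj i j = true → p j = false := by
  rw [isolated, Bool.and_eq_true, Bool.not_eq_true', List.any_eq_false]
  refine and_congr_right fun _ => ?_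
  simp only [List.mem_ofFn, forall_exists_index, forall_apply_eq_imp_iff, id,
    Bool.not_eq_true]
  refine forall_congr' fun j => ?_
  unfold cell
  split_ifs with h
  · simp [h]
  · simp [Ne.symm h]

theorem bitWord_eq_encodeVertexSet {n : ℕ} (p : Fin n → Bool) :
    bitWord p = encodeVertexSet (Finset.univ.filter fun i => p i = true) := by
  simp [bitWord, encodeVertexSet]

theorem ones_bitWord {n : ℕ} (p : Fin n → Bool) :
    ones (bitWord p) = (Finset.univ.filter fun i => p i = true).card := by
  rw [ones, bitWord, List.count, List.ofFn_eq_map, List.countP_map, List.countP_eq_length_filter]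
  change _ = (List.filter (fun i => decide (p i = true)) (List.finRange n)).length
  congr 2
  funext i
  cases h : p i <;> simp [h]

/-- The reduction from independent sets to matrix completion: if all matrices `blowUp ent G` satisfy
the promise, and every solution has a chunk that yields a large independent set, then large
independent sets can be found in polynomial time. -/
theorem solvableInPolyTime_of_blowUp {k r : ℕ} {p ε c μ : ℝ}
    (hQ : (completionProblem k r p ε c μ).SolvableInPolyTime) {L : ℕ}
    (ent : Fin L → Fin L → Letter → Option ℚ) (e k' R : ℕ) (hR : 0 < R)
    (hprom : ∀ (n : ℕ) (adj : Fin n → Fin n → Bool) (G : SimpleGraph (Fin n)),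
      (∀ i j, adj i j = true ↔ G.Adj i j) → 0 < n → G.Colorable k' →
      (completionProblem k r p ε c μ).Promise ⟨L * n, blowUp ent adj⟩)
    (hsol : ∀ (n : ℕ) (adj : Fin n → Fin n → Bool) (G : SimpleGraph (Fin n))
      (B : Matrix (Fin (L * n)) (Fin (L * n)) ℚ),
      (∀ i j, adj i j = true ↔ G.Adj i j) → 0 < n →
      (completionProblem k r p ε c μ).IsSolution ⟨L * n, blowUp ent adj⟩ B →
      ∃ q ∈ chunks e B, n ≤ R * ones (bitWord (isolated adj q))) :
    (independentSetProblem k' R).SolvableInPolyTime := by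
  classical
  obtain ⟨T, time, hT⟩ := hQ
  obtain ⟨C, hC⟩ := exists_length_blowUp_le ent
  obtain ⟨D, hD⟩ := exists_length_output_le T
  obtain ⟨P, hP⟩ := exists_polynomial_reductionCost L e C D time
  refine ⟨(reduction (List.finRange L) (fun a b x => encodeEntry (ent a b x) ++ [.comma]) e
    R).computer T, P, ?_⟩
  rintro ⟨n, G⟩ hG
  set adj : Fin n → Fin n → Bool := fun i j => decide (G.Adj i j) with hadj
  have hadj' : ∀ i j, adj i j = true ↔ G.Adj i j := fun i j => by simp [hadj]
  have henc : (independentSetProblem k' R).encodeInstance ⟨n, G⟩ =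
      encodeMatrix (fun b : Bool => [Letter.bit b]) adj := by
    simp only [independentSetProblem, encodeGraph, hadj]
  rw [henc]
  rcases Nat.eq_zero_or_pos n with hn | hn
  · subst hn
    refine ⟨(∅ : Finset (Fin 0)), ⟨by simp, by simp⟩, ?_⟩
    refine (exec_reduction_nil (T := T) _ _ e R).outputsInTime ?_
    rw [hP]
    omega
  · obtain ⟨B, hB, ⟨hout⟩⟩ := hT _ (hprom n adj G hadj' hn hG)
    obtain ⟨q, hq, hlast⟩ := lastLarge_spec R adj [] _ (hsol n adj G B hadj' hn hB)
    refine ⟨Finset.univ.filter fun i => isolated adj q i = true, ⟨?_, ?_⟩, ?_⟩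
    -- Two adjacent vertices cannot both be isolated in the same set.
    · intro i hi j hj hij hadjij
      simp only [Finset.coe_filter, Finset.mem_univ, true_and, Set.mem_ofPred_eq,
        isolated_iff] at hi hj
      have := hi.2 j hij.symm ((hadj' i j).2 hadjij)
      simp [hj.1] at this
    · rw [← ones_bitWord, div_le_iff₀ (by exact_mod_cast hR)]
      calc (n : ℝ) ≤ ((R * ones (bitWord (isolated adj q)) : ℕ) : ℝ) := by exact_mod_cast hq
        _ = _ := by push_cast; ring
    · change TM2OutputsInTime T.tm ((encodeMatrix encodeEntry (blowUp ent adj)).map _)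
        (some ((encodeMatrix encodeRational B).map _))
        (time.eval (encodeMatrix encodeEntry (blowUp ent adj)).length) at hout
      have hlen := hD _ _ _ ⟨hout⟩
      have hw := hC n adj
      rw [encodeMatrix_blowUp] at hout hlen hw
      obtain ⟨c, hc, hex⟩ := exec_reduction (T := T) _ e R hn adj B hout
      rw [hlast, bitWord_eq_encodeVertexSet] at hex
      refine hex.outputsInTime ?_
      have ht := eval_mono time hw
      -- The cost is a polynomial in `n`, while the bound has to be in terms of the input length,
      -- which is at least `n`.
      have hn' : n ≤ (encodeMatrix (fun b : Bool => [Letter.bit b]) adj).length := by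
        simp [encodeMatrix, List.length_flatten, List.map_ofFn, Function.comp_def]
        exact Nat.le_mul_of_pos_right n (Nat.succ_pos _)
      refine le_trans ?_ (eval_mono P hn')
      simp only [hP]
      refine Nat.add_le_add_right (hc.trans (reductionCost_mono le_rfl hw ht ?_)) 1
      exact hlen.trans (Nat.add_le_add hw (Nat.mul_le_mul_right _ ht))

/-! ### Covering the rows of a matrix of low rank -/

/-- Finitely many vectors of norm at most `2` are covered by `5 ^ dim` balls of radius `1`. -/
theorem exists_cover_unit {E : Type*} [NormedAddCommGroup E] [NormedSpace ℝ E]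
    [FiniteDimensional ℝ E] {ι : Type*} [Fintype ι] (x : ι → E) (hx : ∀ i, ‖x i‖ ≤ 2) {r : ℕ}
    (hr : Module.finrank ℝ E ≤ r) :
    ∃ (g : ι → Fin (5 ^ r)) (c : Fin (5 ^ r) → E), ∀ i, ‖x i - c (g i)‖ ≤ 1 := by
  classical
  -- A largest `1`-separated set of the given points is a `1`-net of them, and a volume argument
  -- bounds its size by `5 ^ dim`.
  let F : Finset (Finset E) := (Finset.univ.image x).powerset.filter
    fun s => ∀ c ∈ s, ∀ d ∈ s, c ≠ d → 1 ≤ ‖c - d‖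
  obtain ⟨s, hs, hmax⟩ := Finset.exists_max_image F Finset.card ⟨∅, by simp [F]⟩
  simp only [F, Finset.mem_filter, Finset.mem_powerset] at hs hmax
  have hcard : s.card ≤ 5 ^ r := by
    refine (Besicovitch.card_le_of_separated s (fun c hc => ?_) hs.2).trans
      (Nat.pow_le_pow_right (by norm_num) hr)
    obtain ⟨i, -, rfl⟩ := Finset.mem_image.1 (hs.1 hc)
    exact hx i
  have hnear : ∀ i, ∃ c ∈ s, ‖x i - c‖ ≤ 1 := by
    intro i
    by_contra! h
    have hi : x i ∉ s := fun hi => by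
      have := h _ hi
      simp at this
      linarith
    have := hmax (insert (x i) s) ⟨?_, ?_⟩
    · rw [Finset.card_insert_of_notMem hi] at this
      omega
    · exact Finset.insert_subset (Finset.mem_image_of_mem _ (Finset.mem_univ _)) hs.1
    · intro c hc d hd hcd
      rcases Finset.mem_insert.1 hc with rfl | hc <;> rcases Finset.mem_insert.1 hd with rfl | hd
      · exact absurd rfl hcd
      · exact (h d hd).le
      · rw [norm_sub_rev]; exact (h c hc).le
      · exact hs.2 c hc d hd hcd
  choose c hcs hc using hnear
  let φ : s → Fin (5 ^ r) := fun y => Fin.castLE hcard (s.equivFin y)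
  have hφ : Function.Injective φ := (Fin.castLE_injective hcard).comp s.equivFin.injective
  -- The value `0` is given only to indices that belong to no centre, and `g` never takes these.
  refine ⟨fun i => φ ⟨c i, hcs i⟩, fun a => Function.extend φ Subtype.val 0 a, fun i => ?_⟩
  simp only [hφ.extend_apply]
  exact hc i

/-- Finitely many vectors of norm at most `2 ^ m` can be distributed to `5 ^ (dim * m)` classes of
diameter at most `2`. -/
theorem exists_classes {E : Type*} [NormedAddCommGroup E] [NormedSpace ℝ E]
    [FiniteDimensional ℝ E] {ι : Type*} [Fintype ι] {r : ℕ} (hr : Module.finrank ℝ E ≤ r) (m : ℕ)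
    (x : ι → E) (hx : ∀ i, ‖x i‖ ≤ 2 ^ m) :
    ∃ f : ι → (Fin m → Fin (5 ^ r)), ∀ i j, f i = f j → ‖x i - x j‖ ≤ 2 := by
  induction m generalizing x with
  | zero =>
    refine ⟨fun _ => Fin.elim0, fun i j _ => (norm_sub_le _ _).trans ?_⟩
    have := hx i
    have := hx j
    rw [pow_zero] at *
    linarith
  | succ m ih =>
    have h2 : (0 : ℝ) < 2 ^ m := by positivity
    -- Rescaled to norm at most `2`, the vectors are covered by unit balls. Subtracting the rescaled
    -- centres leaves vectors of norm at most `2 ^ m`, to which induction applies.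
    obtain ⟨g, c, hc⟩ := exists_cover_unit (fun i => ((2 : ℝ) ^ m)⁻¹ • x i) (fun i => by
      rw [norm_smul, norm_inv, Real.norm_of_nonneg h2.le, inv_mul_le_iff₀ h2, ← pow_succ]
      exact hx i) hr
    obtain ⟨f, hf⟩ := ih (fun i => x i - (2 : ℝ) ^ m • c (g i)) fun i => by
      have h := mul_le_mul_of_nonneg_left (hc i) h2.le
      have h' := norm_smul ((2 : ℝ) ^ m) (((2 : ℝ) ^ m)⁻¹ • x i - c (g i))
      rw [smul_sub, smul_smul, mul_inv_cancel₀ h2.ne', one_smul, Real.norm_of_nonneg h2.le] at h'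
      rwa [mul_one, ← h'] at h
    refine ⟨fun i => Fin.cons (g i) (f i), fun i j hij => ?_⟩
    obtain ⟨hg, hf'⟩ := Fin.cons_inj.1 hij
    have := hf i j hf'
    rwa [hg, sub_sub_sub_cancel_right] at this

/-- The rows of a bounded matrix of rank at most `r` can be distributed to a bounded number of
classes of small diameter. -/
theorem exists_row_classes (r : ℕ) (c : ℝ) {δ : ℝ} (hδ : 0 < δ) :
    ∃ Q : ℕ, 0 < Q ∧ ∀ {n : ℕ} (C : Matrix (Fin n) (Fin n) ℝ), C.rank ≤ r → (∀ i j, |C i j| ≤ c) →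
      ∃ f : Fin n → Fin Q, ∀ i i', f i = f i' → ∀ j, |C i j - C i' j| ≤ δ := by
  -- Scaling by `2 / δ` turns diameter `2` into `δ`. The classes live in the row space with the sup
  -- norm, so `Q` depends on `r`, `c`, `δ` but not on `n`.
  obtain ⟨m, hm⟩ := pow_unbounded_of_one_lt (2 / δ * c) (one_lt_two (α := ℝ))
  refine ⟨Fintype.card (Fin m → Fin (5 ^ r)), Fintype.card_pos_iff.2 ⟨fun _ => ⟨0, by positivity⟩⟩,
    fun {n} C hC hc => ?_⟩
  have h2 : 0 < 2 / δ := by positivity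
  have hmem : ∀ i, (2 / δ) • C.row i ∈ Submodule.span ℝ (Set.range C.row) := fun i =>
    Submodule.smul_mem _ _ (Submodule.subset_span ⟨i, rfl⟩)
  rw [Matrix.rank_eq_finrank_span_row] at hC
  obtain ⟨f, hf⟩ := exists_classes hC m
    (fun i => (⟨_, hmem i⟩ : Submodule.span ℝ (Set.range C.row))) fun i => by
      rw [Submodule.coe_norm, pi_norm_le_iff_of_nonneg (by positivity)]
      intro j
      simp only [Pi.smul_apply, smul_eq_mul, norm_mul, Real.norm_of_nonneg h2.le, Matrix.row]
      exact (mul_le_mul_of_nonneg_left (hc i j) h2.le).trans hm.le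
  refine ⟨fun i => Fintype.equivFin _ (f i), fun i i' h j => ?_⟩
  have h1 := hf i i' ((Fintype.equivFin _).injective h)
  rw [Submodule.coe_norm, AddSubgroupClass.coe_sub, ← smul_sub] at h1
  have h3 := (norm_le_pi_norm _ j).trans h1
  simp only [Pi.smul_apply, smul_eq_mul, norm_mul, Real.norm_of_nonneg h2.le, Matrix.row,
    Pi.sub_apply, Real.norm_eq_abs] at h3
  rw [div_mul_eq_mul_div, div_le_iff₀ hδ] at h3
  linarith

/-! ### The rounding test -/

/-- The assumption says that the denominator is at most the numerator times `2 ^ e`, and bit length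
is monotone. -/
theorem isLarge_of_le {e : ℕ} {q : ℚ} (h : 1 ≤ q * 2 ^ e) : isLarge e q = true := by
  have hq : 0 < q := by
    by_contra! hq
    nlinarith [pow_pos (zero_lt_two (α := ℚ)) e]
  have hnum : 0 < q.num := Rat.num_pos.2 hq
  have hle : q.den ≤ q.num.natAbs * 2 ^ e := by
    have h1 : (q.den : ℚ) ≤ q.num * 2 ^ e := by
      have hd : (0 : ℚ) < q.den := by exact_mod_cast q.den_pos
      have := mul_le_mul_of_nonneg_left h hd.le
      rwa [mul_one, ← mul_assoc, Rat.den_mul_eq_num] at this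
    have h2 : (q.den : ℤ) ≤ q.num * 2 ^ e := by exact_mod_cast h1
    zify
    rwa [abs_of_pos hnum]
  rw [isLarge, decide_eq_true_eq]
  refine ⟨hq, ?_⟩
  rw [← Nat.size_shiftLeft (by simpa using hq.ne'), Nat.shiftLeft_eq]
  exact Nat.size_le_size hle

/-- Bit length determines a number up to a factor of two, which is what the additional factor in the
assumption pays for. -/
theorem isLarge_eq_false {e : ℕ} {q : ℚ} (h : q * 2 ^ (e + 1) ≤ 1) : isLarge e q = false := by
  rw [isLarge, decide_eq_false_iff_not]
  rintro ⟨hq, hsize⟩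
  have hnum : 0 < q.num := Rat.num_pos.2 hq
  have h1 : 2 ^ (q.num.natAbs.size - 1) ≤ q.num.natAbs := by
    refine Nat.lt_size.1 ?_
    have : 0 < q.num.natAbs.size := Nat.size_pos.2 (by simpa using hq.ne')
    omega
  have h0 : 0 < q.num.natAbs.size := Nat.size_pos.2 (by simpa using hq.ne')
  have h2 : q.den < q.num.natAbs * 2 ^ (e + 1) := calc
    q.den < 2 ^ q.den.size := Nat.lt_size_self _
    _ ≤ 2 ^ (q.num.natAbs.size + e) := Nat.pow_le_pow_right (by norm_num) hsize
    _ = 2 ^ (q.num.natAbs.size - 1) * 2 ^ (e + 1) := by rw [← pow_add]; congr 1; omega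
    _ ≤ _ := Nat.mul_le_mul_right _ h1
  have h3 : (q.den : ℚ) < q.num * 2 ^ (e + 1) := by
    have : (q.den : ℤ) < q.num * 2 ^ (e + 1) := by
      zify at h2
      rwa [abs_of_pos hnum] at h2
    exact_mod_cast this
  have hd : (0 : ℚ) < q.den := by exact_mod_cast q.den_pos
  have h4 := mul_le_mul_of_nonneg_left h hd.le
  rw [mul_one, ← mul_assoc, Rat.den_mul_eq_num] at h4
  linarith

/-! ### The matrix of a colouring -/

/-- The matrix with entry `d` at the pairs of equal colour, and `0` elsewhere. -/
def colorMatrix {N k : ℕ} (d : ℝ) (col : Fin N → Fin k) : Matrix (Fin N) (Fin N) ℝ :=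
  fun i j => if col i = col j then d else 0

/-- The normalised indicator vectors of the colour classes are the singular vectors, with singular
values `d` times the class sizes. A row of `U` has a single nonzero entry, the inverse root of a
class size, so large classes mean small coherence. -/
theorem colorMatrix_svd {N k : ℕ} {d μ : ℝ} (hd : 0 < d) (col : Fin N → Fin k) (hN : 0 < N)
    (hcol : ∀ q, (N : ℝ) ≤ k * μ * (Finset.univ.filter fun i => col i = q).card) :
    HasCoherence (colorMatrix d col) k μ ∧ (colorMatrix d col).rank = k := by
  classical
  set m : Fin k → ℝ := fun q => ((Finset.univ.filter fun i => col i = q).card : ℝ) with hm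
  have hN' : (0 : ℝ) < N := by exact_mod_cast hN
  have hm0 : ∀ q, 0 < m q := fun q => by
    have h := hcol q
    have h' : 0 ≤ m q := Nat.cast_nonneg _
    rcases h'.lt_or_eq with h' | h'
    · exact h'
    · have : (N : ℝ) ≤ k * μ * m q := h
      rw [← h'] at this
      simp at this
      omega
  obtain ⟨U, hUdef⟩ : ∃ U : Matrix (Fin N) (Fin k) ℝ,
      ∀ i q, U i q = if col i = q then (√(m q))⁻¹ else 0 := ⟨Matrix.of _, fun _ _ => rfl⟩
  have hU : U.transpose * U = 1 := by
    ext q q'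
    rw [Matrix.mul_apply, Matrix.one_apply]
    simp only [Matrix.transpose_apply, hUdef]
    split_ifs with h
    · subst h
      have : ∀ i, ((if col i = q then (√(m q))⁻¹ else 0) * if col i = q then (√(m q))⁻¹ else 0) =
          if col i = q then (m q)⁻¹ else 0 := by
        intro i
        split_ifs
        · rw [← mul_inv, Real.mul_self_sqrt (hm0 q).le]
        · simp
      simp only [this]
      rw [← Finset.sum_filter, Finset.sum_const, nsmul_eq_mul]
      exact mul_inv_cancel₀ (hm0 q).ne'
    · refine Finset.sum_eq_zero fun i _ => ?_
      by_cases h1 : col i = q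
      · rw [if_neg (show col i ≠ q' from h1 ▸ h), mul_zero]
      · rw [if_neg h1, zero_mul]
  have hM : colorMatrix d col = U * Matrix.diagonal (fun q => d * m q) * U.transpose := by
    ext i j
    rw [Matrix.mul_apply]
    simp only [Matrix.mul_diagonal, Matrix.transpose_apply, hUdef, colorMatrix, ite_mul, zero_mul]
    rw [Finset.sum_ite_eq]
    simp only [Finset.mem_univ, if_true]
    by_cases h : col j = col i
    · rw [if_pos h.symm, if_pos h]
      have := Real.mul_self_sqrt (hm0 (col i)).le
      have h0 := Real.sqrt_pos.2 (hm0 (col i))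
      field_simp
      rw [sq, this]
    · rw [if_neg (Ne.symm h), if_neg h, mul_zero]
  have hrow : ∀ i, √(∑ l, U i l ^ 2) ≤ √(k * μ / N) := by
    intro i
    refine Real.sqrt_le_sqrt ?_
    have : ∀ l, U i l ^ 2 = if col i = l then (m l)⁻¹ else 0 := by
      intro l
      simp only [hUdef]
      split_ifs
      · rw [inv_pow, Real.sq_sqrt (hm0 l).le]
      · simp
    simp only [this]
    rw [Finset.sum_ite_eq, if_pos (Finset.mem_univ _), inv_eq_one_div, div_le_div_iff₀ (hm0 _) hN',
      one_mul]
    exact hcol _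
  refine ⟨⟨U, U, _, hU, hU, fun q => mul_pos hd (hm0 q), hM, hrow, hrow⟩, le_antisymm ?_ ?_⟩
  · rw [hM]
    exact (Matrix.rank_mul_le_left _ _).trans ((Matrix.rank_mul_le_left _ _).trans
      (U.rank_le_width))
  -- For the lower bound on the rank, compress to the singular vectors, which gives an invertible
  -- diagonal matrix.
  · have h1 : U.transpose * colorMatrix d col * U = Matrix.diagonal fun q => d * m q := by
      rw [hM]
      calc _ = (U.transpose * U) * Matrix.diagonal (fun q => d * m q) * (U.transpose * U) := by
            simp only [Matrix.mul_assoc]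
        _ = _ := by rw [hU, Matrix.one_mul, Matrix.mul_one]
    have h2 := Matrix.rank_diagonal fun q => d * m q
    rw [← h1] at h2
    have h3 : Fintype.card { q // d * m q ≠ 0 } = k := by
      rw [Fintype.card_congr (Equiv.subtypeUnivEquiv fun q => (mul_pos hd (hm0 q)).ne'),
        Fintype.card_fin]
    rw [h3] at h2
    refine h2.symm.le.trans ?_
    exact (Matrix.rank_mul_le_left _ _).trans (Matrix.rank_mul_le_right _ _)

/-! ### The completion instance of a graph -/

/-- The entry between two vertices of a graph: the diagonal is `d`, edges are `0`, and non-edges are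
hidden. -/
def vertexEntry (d : ℚ) : Letter → Option ℚ
  | .bot => some d
  | .bit true => some 0
  | _ => none

/-- The entry between two blocks. A block without a colour is a copy of the vertex set of the graph,
a block with a colour consists of isolated vertices of that colour. -/
def blockEntry {L k : ℕ} (d : ℚ) (colour : Fin L → Option (Fin k)) (a b : Fin L) (x : Letter) :
    Option ℚ :=
  match colour a, colour b with
  | none, none => vertexEntry d x
  | some q, some q' => some (if q = q' then d else 0)
  | _, _ => none

theorem blowUp_blockEntry_isSymm {L k n : ℕ} (d : ℚ) (colour : Fin L → Option (Fin k))
    {adj : Fin n → Fin n → Bool} (hadj : ∀ i j, adj i j = adj j i) :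
    (blowUp (blockEntry d colour) adj).IsSymm := by
  have hcell : ∀ i j, cell adj i j = cell adj j i := fun i j => by
    unfold cell
    rw [hadj i j]
    simp only [eq_comm]
  refine Matrix.IsSymm.ext fun I J => ?_
  unfold blowUp blockEntry
  rw [hcell]
  rcases colour (finProdFinEquiv.symm I).1 with _ | q <;>
    rcases colour (finProdFinEquiv.symm J).1 with _ | q' <;> simp only [eq_comm]

theorem card_map_finProdFinEquiv {L : ℕ} (s : Finset (Fin L)) (n : ℕ) :
    ((s ×ˢ (Finset.univ : Finset (Fin n))).map finProdFinEquiv.toEmbedding).card = s.card * n := by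
  simp

/-- It suffices to count positions between two coloured blocks, which are revealed whatever the
graph is. -/
theorem card_revealed_blowUp_blockEntry {L k n : ℕ} (d : ℚ) (colour : Fin L → Option (Fin k))
    (adj : Fin n → Fin n → Bool) :
    ((Finset.univ.filter fun a => (colour a).isSome).card * n) ^ 2 ≤
      (revealed (blowUp (blockEntry d colour) adj)).card := by
  rw [← card_map_finProdFinEquiv, sq, ← Finset.card_product]
  refine Finset.card_le_card fun IJ h => ?_
  obtain ⟨I, J⟩ := IJ
  simp only [Finset.mem_product, Finset.mem_map, Finset.mem_filter, Finset.mem_univ, true_and,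
    and_true, Prod.exists, Equiv.coe_toEmbedding] at h
  obtain ⟨⟨a, i, ha, rfl⟩, b, j, hb, rfl⟩ := h
  obtain ⟨q, hq⟩ := Option.isSome_iff_exists.1 ha
  obtain ⟨q', hq'⟩ := Option.isSome_iff_exists.1 hb
  refine Finset.mem_filter.2 ⟨Finset.mem_univ _, ?_⟩
  simp only [blowUp, blockEntry, Equiv.symm_apply_apply, hq, hq', Option.isSome_some]

/-- The colouring of the blown-up vertex set. -/
def blowUpColour {L k n : ℕ} (colour : Fin L → Option (Fin k)) (χ : Fin n → Fin k)
    (I : Fin (L * n)) : Fin k :=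
  (colour (finProdFinEquiv.symm I).1).getD (χ (finProdFinEquiv.symm I).2)

/-- The coloured blocks alone make every colour class large, however unbalanced `χ` is. -/
theorem card_blowUpColour {L k n : ℕ} (colour : Fin L → Option (Fin k)) (χ : Fin n → Fin k)
    (q : Fin k) :
    (Finset.univ.filter fun a => colour a = some q).card * n ≤
      (Finset.univ.filter fun I => blowUpColour colour χ I = q).card := by
  rw [← card_map_finProdFinEquiv]
  refine Finset.card_le_card fun I h => ?_
  simp only [Finset.mem_product, Finset.mem_map, Finset.mem_filter, Finset.mem_univ, true_and,
    and_true, Prod.exists, Equiv.coe_toEmbedding] at h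
  obtain ⟨a, i, ha, rfl⟩ := h
  refine Finset.mem_filter.2 ⟨Finset.mem_univ _, ?_⟩
  simp only [blowUpColour, Equiv.symm_apply_apply, ha, Option.getD_some]

/-- Between two copies of the graph, equal vertices have equal colours and adjacent ones have
different colours, even if the copies differ; nothing else is revealed there. -/
theorem completes_blowUp_blockEntry {L k n : ℕ} (d : ℚ) (colour : Fin L → Option (Fin k))
    {adj : Fin n → Fin n → Bool} (χ : Fin n → Fin k) (hχ : ∀ i j, adj i j = true → χ i ≠ χ j) :
    Completes (colorMatrix (d : ℝ) (blowUpColour colour χ)) (blowUp (blockEntry d colour) adj) := by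
  intro I J x h
  unfold colorMatrix blowUpColour
  unfold blowUp blockEntry at h
  rcases ha : colour (finProdFinEquiv.symm I).1 with _ | q <;>
    rcases hb : colour (finProdFinEquiv.symm J).1 with _ | q' <;>
    simp only [ha, hb, reduceCtorEq, Option.some.injEq] at h
  · unfold cell at h
    simp only [Option.getD_none]
    split_ifs at h with hij
    · simp only [vertexEntry, Option.some.injEq] at h
      rw [hij, if_pos rfl, h]
    · rcases hx : adj (finProdFinEquiv.symm I).2 (finProdFinEquiv.symm J).2 with _ | _ <;>
        simp only [hx, vertexEntry, reduceCtorEq, Option.some.injEq] at h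
      rw [if_neg (hχ _ _ hx), ← h, Rat.cast_zero]
  · simp only [Option.getD_some]
    rw [← h]
    split_ifs <;> simp

theorem promise_blowUp_blockEntry {L k r n : ℕ} {p ε c μ : ℝ} {d : ℚ} (hd : 0 < d)
    (hdc : (d : ℝ) ≤ c) (colour : Fin L → Option (Fin k)) (hL : 0 < L)
    (hp : p * (L : ℝ) ^ 2 ≤ ((Finset.univ.filter fun a => (colour a).isSome).card : ℝ) ^ 2)
    (hμ : 0 ≤ μ)
    (hcol : ∀ q, (L : ℝ) ≤ k * μ * (Finset.univ.filter fun a => colour a = some q).card)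
    {adj : Fin n → Fin n → Bool} {G : SimpleGraph (Fin n)} (hG : ∀ i j, adj i j = true ↔ G.Adj i j)
    (hn : 0 < n) (hk : G.Colorable k) :
    (completionProblem k r p ε c μ).Promise ⟨L * n, blowUp (blockEntry d colour) adj⟩ := by
  obtain ⟨χ⟩ := hk
  have hd' : (0 : ℝ) < d := by exact_mod_cast hd
  obtain ⟨hcoh, hrank⟩ := colorMatrix_svd (μ := μ) hd' (blowUpColour colour χ)
    (Nat.mul_pos hL hn) fun q => by
      have h1 : ((Finset.univ.filter fun a => colour a = some q).card : ℝ) * n ≤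
          (Finset.univ.filter fun I => blowUpColour colour χ I = q).card := by
        exact_mod_cast card_blowUpColour colour χ q
      calc ((L * n : ℕ) : ℝ) = L * n := by push_cast; ring
        _ ≤ k * μ * (Finset.univ.filter fun a => colour a = some q).card * n := by
          gcongr
          exact hcol q
        _ = k * μ * ((Finset.univ.filter fun a => colour a = some q).card * n) := by ring
        _ ≤ _ := by gcongr
  refine ⟨blowUp_blockEntry_isSymm d colour fun i j => ?_, ?_,
    colorMatrix d (blowUpColour colour χ), ?_, hrank, hcoh, fun I J => ?_, ?_⟩
  · rw [Bool.eq_iff_iff, hG, hG, G.adj_comm]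
  · have h1 : (((Finset.univ.filter fun a => (colour a).isSome).card : ℝ) * n) ^ 2 ≤
        (revealed (blowUp (blockEntry d colour) adj)).card := by
      exact_mod_cast card_revealed_blowUp_blockEntry d colour adj
    refine le_trans ?_ h1
    calc p * ((L * n : ℕ) : ℝ) ^ 2 = p * (L : ℝ) ^ 2 * (n : ℝ) ^ 2 := by push_cast; ring
      _ ≤ _ := by rw [mul_pow]; gcongr
  · exact Matrix.IsSymm.ext fun I J => by simp only [colorMatrix, eq_comm]
  · unfold colorMatrix
    split_ifs
    · rwa [abs_of_pos hd']
    · rw [abs_zero]; exact hd'.le.trans hdc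
  · exact completes_blowUp_blockEntry d colour χ fun i j hij => χ.valid ((hG i j).1 hij)

/-! ### Independent sets from approximate completions -/

/-- The squared error of a value at a position of a partial matrix. -/
def entryError : Option ℚ → ℝ → ℝ
  | none, _ => 0
  | some q, y => (q - y) ^ 2

theorem entryError_nonneg (x : Option ℚ) (y : ℝ) : 0 ≤ entryError x y := by
  rcases x with _ | q
  · exact le_rfl
  · exact sq_nonneg _

theorem squaredError_eq_sum {n : ℕ} (A : Matrix (Fin n) (Fin n) (Option ℚ))
    (B : Matrix (Fin n) (Fin n) ℝ) :
    squaredError A B = ∑ i, ∑ j, entryError (A i j) (B i j) := by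
  rw [squaredError, revealed, Finset.sum_filter, Fintype.sum_prod_type]
  refine Finset.sum_congr rfl fun i _ => Finset.sum_congr rfl fun j _ => ?_
  rcases A i j with _ | q <;> simp [entryError]

/-- Some pair of copies of the graph has at most the average error. -/
theorem exists_copies_error_le {L k n t : ℕ} {d : ℚ} {colour : Fin L → Option (Fin k)}
    (ι : Fin t ↪ Fin L) (hι : ∀ a, colour (ι a) = none) (ht : 0 < t) {η : ℝ}
    (adj : Fin n → Fin n → Bool) (B : Matrix (Fin (L * n)) (Fin (L * n)) ℝ)
    (hB : squaredError (blowUp (blockEntry d colour) adj) B ≤ η * (t : ℝ) ^ 2) :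
    ∃ a b : Fin L, ∑ i, ∑ j, entryError (vertexEntry d (cell adj i j))
      (B (finProdFinEquiv (a, i)) (finProdFinEquiv (b, j))) ≤ η := by
  have : Nonempty (Fin t) := ⟨⟨0, ht⟩⟩
  let W : Fin L × Fin L → ℝ := fun ab => ∑ i, ∑ j,
    entryError (blockEntry d colour ab.1 ab.2 (cell adj i j))
      (B (finProdFinEquiv (ab.1, i)) (finProdFinEquiv (ab.2, j)))
  have hW : ∀ ab, 0 ≤ W ab := fun ab =>
    Finset.sum_nonneg fun _ _ => Finset.sum_nonneg fun _ _ => entryError_nonneg _ _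
  have hsum : squaredError (blowUp (blockEntry d colour) adj) B = ∑ ab, W ab := by
    rw [squaredError_eq_sum, ← finProdFinEquiv.sum_comp, Fintype.sum_prod_type,
      Fintype.sum_prod_type]
    refine Finset.sum_congr rfl fun a _ => Eq.trans (Finset.sum_congr rfl fun i _ => ?_)
      Finset.sum_comm
    rw [← finProdFinEquiv.sum_comp, Fintype.sum_prod_type]
    simp only [blowUp, Equiv.symm_apply_apply]
  -- The errors of the blocks are nonnegative, so the `t ^ 2` pairs of copies together have at most
  -- the total error.
  have hle : ∑ ab : Fin t × Fin t, W (ι ab.1, ι ab.2) ≤ ∑ _ab : Fin t × Fin t, η := by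
    calc ∑ ab : Fin t × Fin t, W (ι ab.1, ι ab.2)
        = ∑ ab ∈ Finset.univ.map (ι.prodMap ι), W ab := by rw [Finset.sum_map]; rfl
      _ ≤ ∑ ab, W ab := Finset.sum_le_sum_of_subset_of_nonneg (Finset.subset_univ _)
          fun ab _ _ => hW ab
      _ ≤ η * (t : ℝ) ^ 2 := hsum ▸ hB
      _ = _ := by simp; ring
  obtain ⟨⟨a, b⟩, -, hab⟩ := Finset.exists_le_of_sum_le Finset.univ_nonempty hle
  refine ⟨ι a, ι b, ?_⟩
  simpa only [W, blockEntry, hι] using hab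

/-- A matrix with few classes of rows that approximates the partial matrix of a graph has a row
that separates many vertices from their neighbours. -/
theorem exists_separating_row {n Q : ℕ} {d : ℚ} (hd : 0 < d) (hn : 0 < n)
    {adj : Fin n → Fin n → Bool} (C : Matrix (Fin n) (Fin n) ℝ) (f : Fin n → Fin Q)
    (hf : ∀ i i', f i = f i' → ∀ j, |C i j - C i' j| ≤ d / 8)
    (hC : ∑ i, ∑ j, entryError (vertexEntry d (cell adj i j)) (C i j) ≤ (d : ℝ) ^ 2 / 128 * n) :
    ∃ (i₀ : Fin n) (S : Finset (Fin n)), n ≤ 2 * Q * S.card ∧ ∀ i ∈ S, (d : ℝ) / 2 ≤ C i₀ i ∧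
      ∀ j, j ≠ i → adj i j = true → C i₀ j ≤ d / 4 := by
  classical
  have hd' : (0 : ℝ) < d := by exact_mod_cast hd
  set w : Fin n → ℝ := fun i => ∑ j, entryError (vertexEntry d (cell adj i j)) (C i j) with hw
  have hw0 : ∀ i, 0 ≤ w i := fun i => Finset.sum_nonneg fun _ _ => entryError_nonneg _ _
  set T : Finset (Fin n) := Finset.univ.filter fun i => w i ≤ (d : ℝ) ^ 2 / 64 with hT
  -- Markov's inequality: the average error of a row is at most half of the threshold that defines
  -- `T`.
  have hgood : n ≤ 2 * T.card := by
    have h1 : ∑ i ∈ Tᶜ, (d : ℝ) ^ 2 / 64 ≤ (d : ℝ) ^ 2 / 128 * n := calc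
      ∑ i ∈ Tᶜ, (d : ℝ) ^ 2 / 64 ≤ ∑ i ∈ Tᶜ, w i := Finset.sum_le_sum fun i hi => by
        simp only [hT, Finset.mem_compl, Finset.mem_filter, Finset.mem_univ, true_and,
          not_le] at hi
        exact hi.le
      _ ≤ ∑ i, w i := Finset.sum_le_sum_of_subset_of_nonneg (Finset.subset_univ _)
          fun i _ _ => hw0 i
      _ ≤ _ := hC
    rw [Finset.sum_const, nsmul_eq_mul] at h1
    have h2 : ((Tᶜ.card : ℕ) : ℝ) * 2 ≤ n := by
      have : (0 : ℝ) < (d : ℝ) ^ 2 / 128 := by positivity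
      nlinarith
    have h3 : Tᶜ.card * 2 ≤ n := by exact_mod_cast h2
    have h4 := Finset.card_add_card_compl T
    rw [Fintype.card_fin] at h4
    omega
  -- Pigeonhole principle for the classes of the good rows.
  obtain ⟨y, hy⟩ : ∃ y, T.card ≤ Q * (T.filter fun i => f i = y).card := by
    by_contra! h
    have h1 : T.card = ∑ y, (T.filter fun i => f i = y).card :=
      Finset.card_eq_sum_card_fiberwise fun i _ => Finset.mem_coe.2 (Finset.mem_univ (f i))
    have hne : (Finset.univ : Finset (Fin Q)).Nonempty := ⟨f ⟨0, hn⟩, Finset.mem_univ _⟩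
    have h2 := Finset.sum_lt_sum_of_nonempty hne fun y _ => h y
    rw [← Finset.mul_sum, ← h1] at h2
    simp at h2
  set S := T.filter fun i => f i = y with hS
  have hnS : n ≤ 2 * Q * S.card := by
    rw [mul_assoc]
    omega
  have hSne : S.Nonempty := by
    rw [← Finset.card_pos]
    by_contra! h
    rw [Nat.le_zero.1 h] at hnS
    omega
  obtain ⟨i₀, hi₀⟩ := hSne
  refine ⟨i₀, S, hnS, fun i hi => ?_⟩
  have hfi : f i₀ = f i := by
    rw [hS, Finset.mem_filter] at hi hi₀
    rw [hi.2, hi₀.2]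
  have hwi : w i ≤ (d : ℝ) ^ 2 / 64 := by
    rw [hS, hT, Finset.mem_filter, Finset.mem_filter] at hi
    exact hi.1.2
  have herr : ∀ j q, vertexEntry d (cell adj i j) = some q → |(q : ℝ) - C i j| ≤ d / 8 := by
    intro j q hq
    have h1 : entryError (vertexEntry d (cell adj i j)) (C i j) ≤ (d : ℝ) ^ 2 / 64 :=
      (Finset.single_le_sum (f := fun j => entryError (vertexEntry d (cell adj i j)) (C i j))
        (fun _ _ => entryError_nonneg _ _) (Finset.mem_univ j)).trans hwi
    rw [hq, entryError] at h1
    refine abs_le_of_sq_le_sq (h1.trans_eq ?_) (by positivity)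
    ring
  refine ⟨?_, fun j hji hij => ?_⟩
  -- Row `i` errs by at most `d / 8` at a revealed position, and row `i₀` differs from it by at most
  -- `d / 8`. So the entry of row `i₀` is within `d / 4` of the revealed value.
  · have h1 := abs_le.1 (herr i d (by simp [cell, vertexEntry]))
    have h2 := abs_le.1 (hf _ _ hfi i)
    linarith [h1.2, h2.1]
  · have h1 := abs_le.1 (herr j 0 (by simp [cell, vertexEntry, hji.symm, hij]))
    have h2 := abs_le.1 (hf _ _ hfi j)
    rw [Rat.cast_zero] at h1
    linarith [h1.1, h2.2]

/-- The separating row of a good pair of copies is one of the chunks. With `d = 2 / 2 ^ e`, the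
bounds `d / 2` and `d / 4` are the two thresholds of `isLarge`. -/
theorem exists_chunk_of_isSolution {L k r n t Q e : ℕ} {p ε c μ : ℝ}
    {colour : Fin L → Option (Fin k)} (ι : Fin t ↪ Fin L) (hι : ∀ a, colour (ι a) = none)
    (ht : 0 < t) (hε : ε * L ≤ ((2 / 2 ^ e : ℚ) : ℝ) ^ 2 / 128 * (t : ℝ) ^ 2)
    (hQ : ∀ C : Matrix (Fin n) (Fin n) ℝ, C.rank ≤ r → (∀ i j, |C i j| ≤ c) →
      ∃ f : Fin n → Fin Q, ∀ i i', f i = f i' → ∀ j, |C i j - C i' j| ≤ ((2 / 2 ^ e : ℚ) : ℝ) / 8)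
    (adj : Fin n → Fin n → Bool) (B : Matrix (Fin (L * n)) (Fin (L * n)) ℚ) (hn : 0 < n)
    (hB : (completionProblem k r p ε c μ).IsSolution
      ⟨L * n, blowUp (blockEntry (2 / 2 ^ e) colour) adj⟩ B) :
    ∃ q ∈ chunks e B, n ≤ 2 * Q * ones (bitWord (isolated adj q)) := by
  obtain ⟨hrank, hbound, herr⟩ := hB
  change (B.map ((↑) : ℚ → ℝ)).rank ≤ r at hrank
  change ∀ i j, |(B i j : ℝ)| ≤ c at hbound
  change squaredError _ (B.map ((↑) : ℚ → ℝ)) ≤ ε * ((L * n : ℕ) : ℝ) at herr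
  have hle : ε * ((L * n : ℕ) : ℝ) ≤ ((2 / 2 ^ e : ℚ) : ℝ) ^ 2 / 128 * n * (t : ℝ) ^ 2 := by
    have := mul_le_mul_of_nonneg_right hε (Nat.cast_nonneg (α := ℝ) n)
    push_cast at this ⊢
    linarith
  obtain ⟨a, b, hab⟩ := exists_copies_error_le ι hι ht adj _ (herr.trans hle)
  obtain ⟨C, hC⟩ : ∃ C : Matrix (Fin n) (Fin n) ℝ, C = (B.map ((↑) : ℚ → ℝ)).submatrix
    (fun i => finProdFinEquiv (a, i)) (fun j => finProdFinEquiv (b, j)) := ⟨_, rfl⟩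
  have hCB : ∀ i j, C i j = (B (finProdFinEquiv (a, i)) (finProdFinEquiv (b, j)) : ℝ) :=
    fun i j => by rw [hC]; rfl
  obtain ⟨f, hf⟩ := hQ C (hC ▸ (Matrix.rank_submatrix_le _ _ _).trans hrank)
    fun i j => by rw [hCB]; exact hbound _ _
  obtain ⟨i₀, S, hS, hsep⟩ := exists_separating_row (adj := adj) (d := 2 / 2 ^ e) (by positivity) hn
    C f hf (by simpa only [hCB, Matrix.map_apply] using hab)
  have h2 : (0 : ℚ) < 2 ^ e := by positivity
  refine ⟨fun j => isLarge e (B (finProdFinEquiv (a, i₀)) (finProdFinEquiv (b, j))), ?_, ?_⟩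
  · rw [chunks, List.mem_flatten]
    exact ⟨_, (List.mem_ofFn' _ _).2 ⟨finProdFinEquiv (a, i₀), rfl⟩,
      (List.mem_ofFn' _ _).2 ⟨b, rfl⟩⟩
  · refine hS.trans (Nat.mul_le_mul_left _ ?_)
    rw [ones_bitWord]
    refine Finset.card_le_card fun i hi => ?_
    rw [Finset.mem_filter, isolated_iff]
    obtain ⟨h3, h4⟩ := hsep i hi
    refine ⟨Finset.mem_univ _, isLarge_of_le ?_, fun j hji hij => isLarge_eq_false ?_⟩
    · rw [hCB] at h3
      have h5 : (2 / 2 ^ e : ℚ) / 2 ≤ B (finProdFinEquiv (a, i₀)) (finProdFinEquiv (b, i)) := by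
        exact_mod_cast h3
      calc (1 : ℚ) = (2 / 2 ^ e : ℚ) / 2 * 2 ^ e := by field_simp
        _ ≤ _ := by gcongr
    · have h6 := h4 j hji hij
      rw [hCB] at h6
      have h5 : B (finProdFinEquiv (a, i₀)) (finProdFinEquiv (b, j)) ≤ (2 / 2 ^ e : ℚ) / 4 := by
        exact_mod_cast h6
      calc _ ≤ (2 / 2 ^ e : ℚ) / 4 * 2 ^ (e + 1) := by gcongr
        _ = 1 := by rw [pow_succ]; field_simp; norm_num

/-! ### The main theorem -/

/-- `t` blocks without a colour, and `s` blocks of each of `k` colours. -/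
theorem exists_block_colouring (t k s : ℕ) :
    ∃ (colour : Fin (t + k * s) → Option (Fin k)) (ι : Fin t ↪ Fin (t + k * s)),
      (∀ a, colour (ι a) = none) ∧
      (∀ q, (Finset.univ.filter fun a => colour a = some q).card = s) ∧
      (Finset.univ.filter fun a => (colour a).isSome).card = k * s := by
  let φ : Fin t ⊕ (Fin k × Fin s) ≃ Fin (t + k * s) :=
    (Equiv.sumCongr (Equiv.refl _) finProdFinEquiv).trans finSumFinEquiv
  let g : Fin t ⊕ (Fin k × Fin s) → Option (Fin k) := Sum.elim (fun _ => none) fun x => some x.1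
  have hcard : ∀ P : Option (Fin k) → Prop, [DecidablePred P] →
      (Finset.univ.filter fun a => P (g (φ.symm a))).card =
        (Finset.univ.filter fun x => P (g x)).card := fun P _ => by
    refine Finset.card_equiv φ.symm fun a => ?_
    simp
  refine ⟨fun a => g (φ.symm a), Function.Embedding.inl.trans φ.toEmbedding,
    fun a => by simp [g], fun q => ?_, ?_⟩
  · rw [hcard fun x => x = some q]
    have : (Finset.univ.filter fun x => g x = some q) =
        Finset.univ.map ((Function.Embedding.sectR q (Fin s)).trans Function.Embedding.inr) := by
      ext x
      rcases x with x | ⟨x, y⟩ <;> simp [g, eq_comm]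
    rw [this]
    simp
  · rw [hcard fun x => x.isSome = true]
    have : (Finset.univ.filter fun x => (g x).isSome = true) =
        Finset.univ.map (Function.Embedding.inr (α := Fin t) (β := Fin k × Fin s)) := by
      ext x
      rcases x with x | ⟨x, y⟩ <;> simp [g]
    rw [this]
    simp

theorem theorem1p9
    (indepSetHard : ∀ k r : ℕ, 3 ≤ k → k ≤ r → ¬ (independentSetProblem k r).SolvableInPolyTime) :
    ∃ μ : ℝ, ∀ (k r : ℕ) (c ε : ℝ), 4 ≤ k → k < r → 0 < c → 0 < ε → ε < 1 / (2 * c * r) ^ 2 →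
      ¬ (completionProblem k r 0.9 ε c μ).SolvableInPolyTime := by
  refine ⟨2, fun k r c ε hk _ hc hε _ hsolv => ?_⟩
  -- This makes `d = 2 / 2 ^ e` at most `c`, as the entries of the completion must be.
  obtain ⟨e, he⟩ := pow_unbounded_of_one_lt (2 / c) (one_lt_two (α := ℝ))
  have hd : (0 : ℚ) < 2 / 2 ^ e := by positivity
  have hd' : (0 : ℝ) < ((2 / 2 ^ e : ℚ) : ℝ) := by exact_mod_cast hd
  have hdc : ((2 / 2 ^ e : ℚ) : ℝ) ≤ c := by
    push_cast
    rw [div_le_iff₀ (by positivity), ← div_le_iff₀' hc]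
    exact he.le
  obtain ⟨Q, hQ0, hQ⟩ := exists_row_classes r c (δ := ((2 / 2 ^ e : ℚ) : ℝ) / 8) (by positivity)
  -- There are `t * (1 + 5 * k)` blocks, so the permitted error grows linearly in `t`, but the
  -- number of pairs of copies grows quadratically.
  obtain ⟨t, ht⟩ := exists_nat_gt (ε * (1 + 5 * k) / (((2 / 2 ^ e : ℚ) : ℝ) ^ 2 / 128))
  have ht0 : 0 < t := by
    have : (0 : ℝ) < t := lt_of_le_of_lt (by positivity) ht
    exact_mod_cast this
  rw [div_lt_iff₀ (by positivity)] at ht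
  have ht0' : (0 : ℝ) < t := by exact_mod_cast ht0
  have hk' : (4 : ℝ) ≤ k := by exact_mod_cast hk
  -- For `k ≥ 4`, the fraction of coloured blocks is at least `20 / 21`, whose square exceeds `0.9`.
  -- Moreover `10 * k * t ≥ t + 5 * k * t`, which gives coherence `2`.
  obtain ⟨colour, ι, hι, hcard, hcard'⟩ := exists_block_colouring t k (5 * t)
  -- The density `2 * Q` would do for the extraction; the factor `k` ensures that the parameter is
  -- at least `k`.
  refine indepSetHard k (2 * (Q * k)) (by omega) ?_ (solvableInPolyTime_of_blowUp hsolv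
    (blockEntry (2 / 2 ^ e) colour) e k _ (by positivity)
    (fun n adj G hG hn hcol => promise_blowUp_blockEntry hd hdc colour (by positivity) ?_
      zero_le_two (fun q => ?_) hG hn hcol)
    fun n adj G B _ hn hB => ?_)
  · nlinarith
  · rw [hcard']
    push_cast
    have h1 : (t + k * (5 * t) : ℝ) ^ 2 = t ^ 2 * (1 + 5 * k) ^ 2 := by ring
    have h2 : (k * (5 * t) : ℝ) ^ 2 = t ^ 2 * (5 * k) ^ 2 := by ring
    rw [h1, h2, mul_left_comm]
    refine mul_le_mul_of_nonneg_left ?_ (sq_nonneg _)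
    nlinarith
  · rw [hcard q]
    push_cast
    nlinarith
  · obtain ⟨q, hq, hle⟩ := exists_chunk_of_isSolution ι hι ht0 (by
      push_cast at ht ⊢
      nlinarith) (fun C => hQ C) adj B hn hB
    refine ⟨q, hq, hle.trans (Nat.mul_le_mul_right _ ?_)⟩
    nlinarith
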